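/- Let $H$ be a complex Hilbert space, let $\mathcal N\subseteq B(H)$ be a von Neumann algebra with a faithful normal semifinite trace $\tau$ such that $\tau(1)=\infty$, and suppose that either $\mathcal N$ is diffuse (has no minimal projections) or $\mathcal N=B(H)$. For $A\in\mathcal N$ and $t\ge 0$ put $\mu(t,A)=\inf\{\|Ap\| : p\in\mathcal N \text{ a projection},\ \tau(1-p)\le t\}$, and let $\mathcal M_{1,\infty}$ be the set of all $A\in\mathcal N$ with $$\sup_{t>0}\frac1{\log(1+t)}\int_0^t\mu(s,A)\,ds<\infty .$$ A generalised limit is a positive linear functional $\omega:L_\infty(0,\infty)\to\mathbb R$ with $\omega(1)=1$ and $\omega(z)=0$ for every $z\in L_\infty(0,\infty)$ with $\lim_{t\to\infty}z(t)=0$; it is dilation invariant if $\omega(z(\cdot/s))=\omega(z)$ for all $z\in L_\infty(0,\infty)$ and all $s>0$. Let $$(Mx)(t)=\frac1{\log t}\int_1^t x(s)\,\frac{ds}{s}$$ be the Cesàro operator. For $0<q<\infty$, a positive operator $A\in\mathcal M_{1,\infty}$ and a dilation invariant generalised limit $\omega$ put $$\tau_\omega(A)=\omega\Big(t\mapsto\frac1{\log(1+t)}\int_0^t\mu(s,A)\,ds\Big),\qquad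 \xi_\omega(A)=(\omega\circ M)\Big(t\mapsto\frac1t\,\tau\big(\exp(-(tA)^{-q})\big)\Big),$$ where $\exp(-(tA)^{-q})$ is given by the functional calculus with the function $u\mapsto \exp(-(tu)^{-q})$ on $[0,\infty)$, taken to be $0$ at $u=0$. Theorem. For every $0<q<\infty$ there exist a positive operator $A\in\mathcal M_{1,\infty}$ and a dilation invariant generalised limit $\omega$ on $L_\infty(0,\infty)$ such that $\tau_\omega(A)$ and $\xi_\omega(A)$ are well defined (the traces $\tau(\exp(-(tA)^{-q}))$, $t>0$, are finite, the function $t\mapsto\frac1t\tau(\exp(-(tA)^{-q}))$ is locally integrable on $(0,\infty)$, and the two functions to which $\omega$ is applied belong to $L_\infty(0,\infty)$) and $$\Gamma\Big(1+\frac1q\Big)\,\tau_\omega(A)<\xi_\omega(A).$$ In particular, the identity $\xi_\omega=\Gamma(1+\frac1q)\,\tau_\omega$ does not hold for every dilation invariant generalised limit $\omega$. -/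

import Mathlib

open MeasureTheory Filter Topology
open scoped ENNReal

noncomputable section

namespace NoncommHeat

section LInfinity

/-- Lebesgue measure on the half-line `(0, ∞)`. -/
def halfLine : Measure ℝ := volume.restrict (Set.Ioi 0)

/-- The real Banach lattice `L_∞(0, ∞)`. -/
abbrev LInfty : Type := Lp ℝ ∞ halfLine

theorem memLp_dilate {z : ℝ → ℝ} (hz : MemLp z ∞ halfLine) {s : ℝ} (hs : 0 < s) :
    MemLp (fun t => z (t / s)) ∞ halfLine := by
  have hq : Measure.QuasiMeasurePreserving (fun t : ℝ => t / s) halfLine halfLine := by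
    have hm : Measurable (fun t : ℝ => t / s) := measurable_id.div_const s
    refine ⟨hm, ?_⟩
    refine Measure.AbsolutelyContinuous.mk fun A hA h0 => ?_
    rw [Measure.map_apply hm hA]
    rw [halfLine, Measure.restrict_apply hA] at h0
    rw [halfLine, Measure.restrict_apply (hm hA)]
    have heq : (fun t : ℝ => t / s) ⁻¹' A ∩ Set.Ioi 0
        = (fun t : ℝ => t * s⁻¹) ⁻¹' (A ∩ Set.Ioi 0) := by
      ext t
      simp only [Set.mem_inter_iff, Set.mem_preimage, Set.mem_Ioi, div_eq_mul_inv]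
      have : 0 < t * s⁻¹ ↔ 0 < t := by
        rw [mul_pos_iff_of_pos_right (inv_pos.mpr hs)]
      rw [this]
    rw [heq, Real.volume_preimage_mul_right (inv_ne_zero hs.ne'), h0, mul_zero]
  refine memLp_top_of_bound (hz.1.comp_quasiMeasurePreserving hq)
    (eLpNorm z ∞ halfLine).toReal ?_
  have hb : ∀ᵐ t ∂halfLine, ‖z t‖ ≤ (eLpNorm z ∞ halfLine).toReal := by
    filter_upwards [ae_le_eLpNormEssSup (f := z) (μ := halfLine)] with t ht
    have h2 := hz.2
    rw [eLpNorm_exponent_top] at h2 ⊢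
    simpa using ENNReal.toReal_mono h2.ne ht
  exact hq.ae hb

/-- A generalised limit: a positive normalised linear functional on `L_∞(0, ∞)` that vanishes on
every bounded function tending to zero at infinity. -/
structure IsGeneralisedLimit (ω : LInfty →ₗ[ℝ] ℝ) : Prop where
  nonneg : ∀ z : LInfty, 0 ≤ z → 0 ≤ ω z
  normalised : ω ((memLp_top_const (1 : ℝ)).toLp (fun _ => 1)) = 1
  vanishes : ∀ (z : ℝ → ℝ) (hz : MemLp z ∞ halfLine),
    Tendsto z atTop (𝓝 0) → ω (hz.toLp z) = 0

/-- Invariance under all the dilations `(σ_s z)(t) = z (t / s)`, `s > 0`. -/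
def IsDilationInvariant (ω : LInfty →ₗ[ℝ] ℝ) : Prop :=
  ∀ (z : ℝ → ℝ) (hz : MemLp z ∞ halfLine) (s : ℝ) (hs : 0 < s),
    ω ((memLp_dilate hz hs).toLp (fun t => z (t / s))) = ω (hz.toLp z)

open Classical in
/-- The value `ω(z)` for a function `z` representing an element of `L_∞(0, ∞)`
(and the junk value `0` for other functions). -/
def evalAt (ω : LInfty →ₗ[ℝ] ℝ) (z : ℝ → ℝ) : ℝ :=
  if hz : MemLp z ∞ halfLine then ω (hz.toLp z) else 0

/-- The Cesàro operator `(M x)(t) = (1 / log t) ∫_1^t x(s) ds / s`. -/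
def cesaro (x : ℝ → ℝ) (t : ℝ) : ℝ :=
  (1 / Real.log t) * ∫ s in (1 : ℝ)..t, x s / s

end LInfinity

section Operators

variable {H : Type*} [NormedAddCommGroup H] [InnerProductSpace ℂ H] [CompleteSpace H]

/-- A faithful normal semifinite trace on the von Neumann algebra `N`. Only the values on the
positive cone of `N` are meaningful, and only these are constrained or used. -/
structure FNSTrace (N : VonNeumannAlgebra H) where
  /-- the underlying weight -/
  toFun : (H →L[ℂ] H) → ℝ≥0∞
  map_add : ∀ a ∈ N, ∀ b ∈ N, 0 ≤ a → 0 ≤ b → toFun (a + b) = toFun a + toFun b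
  map_smul : ∀ a ∈ N, 0 ≤ a → ∀ c : ℝ, 0 ≤ c →
    toFun ((c : ℂ) • a) = ENNReal.ofReal c * toFun a
  tracial : ∀ x ∈ N, toFun (star x * x) = toFun (x * star x)
  faithful : ∀ a ∈ N, 0 ≤ a → toFun a = 0 → a = 0
  /-- normality: suprema of bounded upward directed families of positive elements are preserved -/
  normal : ∀ S : Set (H →L[ℂ] H), S.Nonempty → (∀ x ∈ S, x ∈ N ∧ 0 ≤ x) →
    DirectedOn (· ≤ ·) S → ∀ a ∈ N, IsLUB S a → toFun a = ⨆ x ∈ S, toFun x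
  semifinite : ∀ a ∈ N, 0 ≤ a → a ≠ 0 → ∃ b ∈ N, 0 ≤ b ∧ b ≤ a ∧ b ≠ 0 ∧ toFun b ≠ ∞

/-- `N` is diffuse: it has no minimal projection. -/
def IsDiffuse (N : VonNeumannAlgebra H) : Prop :=
  ¬ ∃ p ∈ N, IsStarProjection p ∧ p ≠ 0 ∧
    ∀ r ∈ N, IsStarProjection r → r ≤ p → r = 0 ∨ r = p

variable {N : VonNeumannAlgebra H}

/-- The generalised singular value function
`μ(t, A) = inf {‖A p‖ : p a projection of N with τ(1 - p) ≤ t}`, for `t ≥ 0`. -/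
def singularValue (τ : FNSTrace N) (A : H →L[ℂ] H) (t : ℝ) : ℝ :=
  sInf {r : ℝ | ∃ p ∈ N, IsStarProjection p ∧ τ.toFun (1 - p) ≤ ENNReal.ofReal t ∧ r = ‖A * p‖}

/-- The function `t ↦ (1 / log (1 + t)) ∫_0^t μ(s, A) ds`. -/
def dixmierMean (τ : FNSTrace N) (A : H →L[ℂ] H) (t : ℝ) : ℝ :=
  (1 / Real.log (1 + t)) * ∫ s in (0 : ℝ)..t, singularValue τ A s

/-- The Dixmier ideal `𝓜_{1,∞}(N, τ)`. -/
def dixmierIdeal (τ : FNSTrace N) : Set (H →L[ℂ] H) :=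
  {A | A ∈ N ∧ BddAbove (dixmierMean τ A '' Set.Ioi 0)}

/-- The Dixmier trace `τ_ω(A)` of a positive operator `A` in the Dixmier ideal. -/
def dixmierTrace (τ : FNSTrace N) (ω : LInfty →ₗ[ℝ] ℝ) (A : H →L[ℂ] H) : ℝ :=
  evalAt ω (dixmierMean τ A)

/-- The function `u ↦ exp (-(t u)^(-q))` on `[0, ∞)`, with its limit value `0` at `u = 0`. -/
def heatProfile (q t u : ℝ) : ℝ :=
  if u ≤ 0 then 0 else Real.exp (-(t * u) ^ (-q))

/-- The operator `exp (-(t A)^(-q))`, by continuous functional calculus. -/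
def heatOperator (q : ℝ) (A : H →L[ℂ] H) (t : ℝ) : H →L[ℂ] H :=
  cfc (heatProfile q t) A

/-- The heat kernel function `t ↦ (1 / t) τ(exp (-(t A)^(-q)))`. -/
def heatKernel (τ : FNSTrace N) (q : ℝ) (A : H →L[ℂ] H) (t : ℝ) : ℝ :=
  (1 / t) * (τ.toFun (heatOperator q A t)).toReal

/-- The heat kernel functional `ξ_ω(A) = (ω ∘ M)(t ↦ (1 / t) τ(exp (-(t A)^(-q))))` of a positive
operator `A` in the Dixmier ideal. -/
def heatFunctional (τ : FNSTrace N) (q : ℝ) (ω : LInfty →ₗ[ℝ] ℝ) (A : H →L[ℂ] H) : ℝ :=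
  evalAt ω (cesaro (heatKernel τ q A))

end Operators

end NoncommHeat

end

open NoncommHeat MeasureTheory
open scoped ENNReal

/-! Since `τ 1 = ∞` and `τ` is semifinite, `N` contains mutually orthogonal projections `p n` of
finite traces `exp (L n)`, with `L n` growing as fast as we like. Take `A = ∑ a n • p n` with
`a n = L n * exp (-L n)`, so that `τ (a n • p n) = L n`.

Look at the window `2 / a n ≤ t ≤ √(L n) / a n`. Its logarithmic length tends to infinity, and
`log t` is comparable to `L n` on it. The eigenvalues before `a n` have total trace at most
`√(L n)`, and `t * a n ≤ √(L n)`, so the integral of `μ(s, A)` over `[0, t]` is `O(√(L n))` and its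
quotient by `log t` tends to zero. On the other hand `exp (-(s * a n) ^ (-q)) ≥ exp (-1)` for
`s ≥ 1 / a n`, so the `n`-th eigenvalue alone contributes at least `exp (-1) * exp (L n) / s` to the
heat kernel at `s`; integrating against `ds / s` over `[1 / a n, 2 / a n]` gives a multiple of
`exp (L n) * a n = L n`, so the Cesàro mean stays bounded away from zero.

An ultrafilter limit of the averages over these windows against `dt / t` is a dilation invariant
generalised limit `ω`, because the windows escape to infinity and their logarithmic length does too.
Thus `τ_ω(A) = 0 < ξ_ω(A)` for every `q`.
-/

namespace NoncommHeat

variable {H : Type*} [NormedAddCommGroup H] [InnerProductSpace ℂ H] [CompleteSpace H]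
  {N : VonNeumannAlgebra H}

section VonNeumann

theorem isClosed_vonNeumannAlgebra (N : VonNeumannAlgebra H) :
    IsClosed (N : Set (H →L[ℂ] H)) := by
  rw [← N.centralizer_centralizer]
  exact Set.isClosed_centralizer _

theorem real_smul_mem {x : H →L[ℂ] H} (hx : x ∈ N) (c : ℝ) : c • x ∈ N := by
  rw [← Complex.coe_smul]
  exact N.toStarSubalgebra.smul_mem hx (c : ℂ)

theorem cfc_mem {x : H →L[ℂ] H} (hx : x ∈ N) (f : ℝ → ℝ) : cfc f x ∈ N := by
  rw [← N.commutant_commutant, VonNeumannAlgebra.mem_commutant_iff]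
  intro y hy
  have hcomm : Commute x y := VonNeumannAlgebra.mem_commutant_iff.mp hy x hx
  exact (hcomm.cfc_real f).eq.symm

theorem starProjection_mem (K : Submodule ℂ H) [K.HasOrthogonalProjection]
    (h : ∀ y ∈ N.commutant, ∀ x ∈ K, y x ∈ K) : K.starProjection ∈ N := by
  rw [VonNeumannAlgebra.IsStarProjection.mem_iff isStarProjection_starProjection,
    Submodule.range_starProjection]
  exact h

theorem exists_eigenprojection {m : H →L[ℂ] H} (hm : m ∈ N) (c : ℝ) :
    ∃ r ∈ N, IsStarProjection r ∧ m * r = c • r ∧ ∀ x, m x = c • x → r x = x := by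
  let K : Submodule ℂ H := (m - c • (1 : H →L[ℂ] H)).ker
  have mem_K : ∀ x, x ∈ K ↔ m x = c • x := fun x => by
    simp [K, LinearMap.mem_ker, sub_eq_zero]
  have : CompleteSpace K := (ContinuousLinearMap.isClosed_ker _).completeSpace_coe
  refine ⟨K.starProjection, starProjection_mem K fun z hz x hx => ?_,
    isStarProjection_starProjection, ?_,
    fun x hx => Submodule.starProjection_eq_self_iff.mpr ((mem_K x).mpr hx)⟩
  · have hcomm : m (z x) = z (m x) :=
      DFunLike.congr_fun (VonNeumannAlgebra.mem_commutant_iff.mp hz m hm) x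
    rw [mem_K, hcomm, (mem_K x).mp hx]
    exact map_real_smul z z.continuous c x
  · ext x
    exact (mem_K _).mp (Submodule.starProjection_apply_mem K x)

theorem smul_le_of_mul_eq_smul {m r : H →L[ℂ] H} (hm : 0 ≤ m) (hr : IsStarProjection r) {c : ℝ}
    (h : m * r = c • r) : c • r ≤ m := by
  have h' : r * m = c • r := by
    simpa [hr.isSelfAdjoint.star_eq, (IsSelfAdjoint.of_nonneg hm).star_eq] using congrArg star h
  have hconj : star (1 - r) * m * (1 - r) = m - c • r := by
    rw [hr.one_sub.isSelfAdjoint.star_eq, sub_mul, one_mul, h', mul_sub, mul_one, sub_mul, h,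
      smul_mul_assoc, hr.isIdempotentElem.eq]
    abel
  exact sub_nonneg.mp (hconj ▸ star_left_conjugate_nonneg hm (1 - r))

theorem exists_le_mul_eq_smul {b : H →L[ℂ] H} (hb : b ∈ N) (hb0 : 0 ≤ b) (hne : b ≠ 0) :
    ∃ ε : ℝ, 0 < ε ∧ ∃ m ∈ N, 0 ≤ m ∧ m ≤ b ∧ ∃ y : H →L[ℂ] H, y ≠ 0 ∧ m * y = ε • y := by
  have := nontrivial_of_ne b 0 hne
  have hnorm : 0 < ‖b‖ := norm_pos_iff.mpr hne
  set ε : ℝ := ‖b‖ / 2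
  have hε : 0 < ε := by positivity
  -- `m = min b ε` and `y = max (b - ε) 0`, since `min x ε = ε` wherever `max (x - ε) 0 ≠ 0`
  refine ⟨ε, hε, cfc (fun x : ℝ => min x ε) b, cfc_mem hb _,
    cfc_nonneg fun x hx => le_min (spectrum_nonneg_of_nonneg hb0 hx) hε.le, ?_,
    cfc (fun x : ℝ => max (x - ε) 0) b, fun h0 => ?_, ?_⟩
  · exact (cfc_mono fun x _ => min_le_left x ε).trans_eq (cfc_id' ℝ b)
  · rw [← cfc_zero ℝ b, cfc_eq_cfc_iff_eqOn] at h0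
    have : max (‖b‖ - ε) 0 = 0 := h0 (CStarAlgebra.norm_mem_spectrum_of_nonneg hb0)
    grind
  · rw [← cfc_mul .., ← cfc_const_mul ..]
    refine cfc_congr fun x _ => ?_
    rcases le_total x ε with h | h
    · simp [max_eq_right (sub_nonpos.mpr h)]
    · simp [min_eq_right h]

theorem exists_smul_projection_le {b : H →L[ℂ] H} (hb : b ∈ N) (hb0 : 0 ≤ b) (hne : b ≠ 0) :
    ∃ ε : ℝ, 0 < ε ∧ ∃ r ∈ N, IsStarProjection r ∧ r ≠ 0 ∧ ε • r ≤ b := by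
  obtain ⟨ε, hε, m, hm, hm0, hmb, y, hy, hmy⟩ := exists_le_mul_eq_smul hb hb0 hne
  obtain ⟨r, hr, hrp, hmr, hfix⟩ := exists_eigenprojection hm ε
  refine ⟨ε, hε, r, hr, hrp, ?_, (smul_le_of_mul_eq_smul hm0 hrp hmr).trans hmb⟩
  rintro rfl
  exact hy (ContinuousLinearMap.ext fun x => (hfix (y x) (DFunLike.congr_fun hmy x)).symm)

end VonNeumann

section DirectedProjections

theorem isLUB_range_starProjection {ι : Type*} [Preorder ι] [IsDirectedOrder ι] [Nonempty ι]
    {U : ι → Submodule ℂ H} [∀ i, (U i).HasOrthogonalProjection] (hU : Monotone U)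
    [(⨆ i, U i).topologicalClosure.HasOrthogonalProjection] :
    IsLUB (Set.range fun i => (U i).starProjection)
      (⨆ i, U i).topologicalClosure.starProjection := by
  refine ⟨?_, fun T hT => ?_⟩
  · rintro _ ⟨i, rfl⟩
    exact Submodule.starProjection_le_starProjection_iff.mpr
      ((le_iSup U i).trans (Submodule.le_topologicalClosure _))
  · have hle : ∀ i, (T - (U i).starProjection).IsPositive := fun i =>
      ContinuousLinearMap.le_def _ _ |>.mp (hT (Set.mem_range_self i))
    have hT0 : 0 ≤ T := isStarProjection_starProjection.nonneg.trans
      (hT (Set.mem_range_self (Classical.arbitrary ι)))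
    rw [ContinuousLinearMap.le_def, ContinuousLinearMap.isPositive_def']
    refine ⟨(IsSelfAdjoint.of_nonneg hT0).sub isStarProjection_starProjection.isSelfAdjoint,
      fun x => ?_⟩
    have hlim : Tendsto (fun i => (T - (U i).starProjection).reApplyInnerSelf x) atTop
        (𝓝 ((T - (⨆ i, U i).topologicalClosure.starProjection).reApplyInnerSelf x)) := by
      simp only [ContinuousLinearMap.reApplyInnerSelf_apply, _root_.sub_apply]
      have := tendsto_const_nhds (x := T x) |>.sub
        (Submodule.starProjection_tendsto_closure_iSup U hU x)
      exact (RCLike.continuous_re.tendsto _).comp (this.inner tendsto_const_nhds)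
    exact ge_of_tendsto hlim (Eventually.of_forall fun i =>
      (ContinuousLinearMap.isPositive_def'.mp (hle i)).2 x)

theorem closure_iSup_range_invariant {𝕜 E ι : Type*} [NontriviallyNormedField 𝕜]
    [NormedAddCommGroup E] [NormedSpace 𝕜 E] {p : ι → E →L[𝕜] E} {y : E →L[𝕜] E}
    (hy : ∀ i, Commute (p i) y) :
    ∀ x ∈ (⨆ i, (p i).range).topologicalClosure, y x ∈ (⨆ i, (p i).range).topologicalClosure := by
  set K := (⨆ i, (p i).range).topologicalClosure
  suffices h : K ≤ K.comap y.toLinearMap from h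
  refine Submodule.topologicalClosure_minimal _ (iSup_le fun i => ?_)
    ((Submodule.isClosed_topologicalClosure _).preimage y.continuous)
  rintro _ ⟨w, rfl⟩
  have hw : p i (y w) = y (p i w) := DFunLike.congr_fun (hy i) w
  exact Submodule.le_topologicalClosure _ (le_iSup (fun i => (p i).range) i ⟨y w, hw⟩)

theorem exists_isLUB_of_directedOn {S : Set (H →L[ℂ] H)} (hne : S.Nonempty)
    (hS : ∀ p ∈ S, p ∈ N ∧ IsStarProjection p) (hdir : DirectedOn (· ≤ ·) S) :
    ∃ P ∈ N, IsStarProjection P ∧ IsLUB S P := by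
  have hproj : ∀ p : S, ∃ (_ : (p : H →L[ℂ] H).range.HasOrthogonalProjection),
      (p : H →L[ℂ] H) = (p : H →L[ℂ] H).range.starProjection := fun p =>
    isStarProjection_iff_eq_starProjection_range.mp (hS p p.2).2
  choose _ hU using hproj
  have hmono : Monotone fun p : S => (p : H →L[ℂ] H).range := by
    intro p q hpq
    have hle : (p : H →L[ℂ] H) ≤ q := hpq
    rw [hU p, hU q] at hle
    exact Submodule.starProjection_le_starProjection_iff.mp hle
  have : Nonempty S := hne.to_subtype
  have : IsDirectedOrder S := hdir.isDirectedOrder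
  have : CompleteSpace (⨆ p : S, (p : H →L[ℂ] H).range).topologicalClosure :=
    (Submodule.isClosed_topologicalClosure _).completeSpace_coe
  refine ⟨(⨆ p : S, (p : H →L[ℂ] H).range).topologicalClosure.starProjection,
    starProjection_mem _ fun y hy => closure_iSup_range_invariant fun p =>
      VonNeumannAlgebra.mem_commutant_iff.mp hy p (hS p p.2).1,
    isStarProjection_starProjection, ?_⟩
  convert isLUB_range_starProjection hmono
  simp only [← hU, Subtype.range_coe]

end DirectedProjections

section OrthogonalProjections

/-- A family of mutually orthogonal orthogonal projections of `H`, the spectral projections of the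
operators `∑ b i • p i`. -/
structure IsOrthogonalProjections {ι : Type*} (p : ι → H →L[ℂ] H) : Prop where
  isStarProjection : ∀ i, IsStarProjection (p i)
  mul_eq_zero : Pairwise fun i j => p i * p j = 0

theorem isOrthogonalProjections_sub_of_monotone {P : ℕ → H →L[ℂ] H}
    (hP : ∀ n, IsStarProjection (P n)) (hmono : Monotone P) :
    IsOrthogonalProjections fun n => P (n + 1) - P n := by
  have absorb : ∀ i j, i ≤ j → P i * P j = P i := fun i j hij =>
    ((hP i).le_iff_mul_eq_left (hP j)).mp (hmono hij)
  have absorb' : ∀ i j, i ≤ j → P j * P i = P i := fun i j hij =>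
    ((hP i).le_iff_mul_eq_right (hP j)).mp (hmono hij)
  refine ⟨fun n => ((hP n).le_iff_sub (hP (n + 1))).mp (hmono n.le_succ), fun i j hij => ?_⟩
  rcases lt_or_gt_of_ne hij with h | h
  · rw [sub_mul, mul_sub, mul_sub, absorb (i + 1) (j + 1) (by lia), absorb (i + 1) j h,
      absorb i (j + 1) (by lia), absorb i j h.le, sub_self, sub_self, sub_self]
  · rw [sub_mul, mul_sub, mul_sub, absorb' (j + 1) (i + 1) (by lia), absorb' j (i + 1) (by lia),
      absorb' (j + 1) i h, absorb' j i h.le, sub_self]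

end OrthogonalProjections

namespace FNSTrace

theorem map_zero (τ : FNSTrace N) : τ.toFun 0 = 0 := by
  simpa using τ.map_smul 0 (zero_mem N) le_rfl 0 le_rfl

theorem map_real_smul (τ : FNSTrace N) {a : H →L[ℂ] H} (ha : a ∈ N) (h0 : 0 ≤ a) {c : ℝ}
    (hc : 0 ≤ c) : τ.toFun (c • a) = ENNReal.ofReal c * τ.toFun a := by
  rw [← τ.map_smul a ha h0 c hc, Complex.coe_smul]

theorem map_eq_add_map_sub (τ : FNSTrace N) {a b : H →L[ℂ] H} (ha : a ∈ N) (hb : b ∈ N)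
    (h0 : 0 ≤ a) (hab : a ≤ b) : τ.toFun b = τ.toFun a + τ.toFun (b - a) := by
  rw [← τ.map_add a ha _ (sub_mem hb ha) h0 (sub_nonneg.mpr hab), add_sub_cancel]

theorem mono (τ : FNSTrace N) {a b : H →L[ℂ] H} (ha : a ∈ N) (hb : b ∈ N) (h0 : 0 ≤ a)
    (hab : a ≤ b) : τ.toFun a ≤ τ.toFun b := by
  rw [τ.map_eq_add_map_sub ha hb h0 hab]
  exact le_self_add

theorem map_sum (τ : FNSTrace N) {ι : Type*} (s : Finset ι) {f : ι → H →L[ℂ] H}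
    (hf : ∀ i, f i ∈ N) (h0 : ∀ i, 0 ≤ f i) :
    τ.toFun (∑ i ∈ s, f i) = ∑ i ∈ s, τ.toFun (f i) := by
  classical
  induction s using Finset.induction_on with
  | empty => simp [τ.map_zero]
  | insert i s hi ih =>
    rw [Finset.sum_insert hi, Finset.sum_insert hi, ← ih]
    exact τ.map_add _ (hf i) _ (sum_mem fun j _ => hf j) (h0 i) (Finset.sum_nonneg fun j _ => h0 j)

theorem map_tsum (τ : FNSTrace N) {ι : Type*} {f : ι → H →L[ℂ] H} (hf : ∀ i, f i ∈ N)
    (h0 : ∀ i, 0 ≤ f i) (hs : Summable f) : τ.toFun (∑' i, f i) = ∑' i, τ.toFun (f i) := by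
  have hmem : ∑' i, f i ∈ N := (isClosed_vonNeumannAlgebra N).mem_of_tendsto hs.hasSum
    (Eventually.of_forall fun s => sum_mem fun j _ => hf j)
  have hdir : DirectedOn (· ≤ ·) (Set.range fun s : Finset ι => ∑ i ∈ s, f i) :=
    directedOn_range.mpr <| Monotone.directed_le fun _ _ hst =>
      Finset.sum_le_sum_of_subset_of_nonneg hst fun i _ _ => h0 i
  rw [τ.normal _ (Set.range_nonempty _) ?_ hdir _ hmem (isLUB_hasSum h0 hs.hasSum), iSup_range,
    ENNReal.tsum_eq_iSup_sum]
  · exact iSup_congr fun s => τ.map_sum s hf h0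
  · rintro _ ⟨s, rfl⟩
    exact ⟨sum_mem fun j _ => hf j, Finset.sum_nonneg fun j _ => h0 j⟩

theorem exists_finite_subprojection (τ : FNSTrace N) {e : H →L[ℂ] H} (he : e ∈ N)
    (hp : IsStarProjection e) (hne : e ≠ 0) :
    ∃ r ∈ N, IsStarProjection r ∧ r ≠ 0 ∧ r ≤ e ∧ τ.toFun r ≠ ∞ := by
  obtain ⟨b, hb, hb0, hbe, hbne, hbfin⟩ := τ.semifinite e he hp.nonneg hne
  obtain ⟨ε, hε, r, hr, hrp, hrne, hrb⟩ := exists_smul_projection_le hb hb0 hbne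
  have hεr : 0 ≤ ε • r := smul_nonneg hε.le hrp.nonneg
  refine ⟨r, hr, hrp, hrne, ?_, fun htop => hbfin (top_le_iff.mp ?_)⟩
  · have hmul := (hp.mul_right_and_mul_left_of_nonneg_of_le hεr (hrb.trans hbe)).1
    rw [smul_mul_assoc] at hmul
    exact (hrp.le_iff_mul_eq_left hp).mpr (smul_right_injective _ hε.ne' hmul)
  · have hle := τ.mono (real_smul_mem hr ε) hb hεr hrb
    rwa [τ.map_real_smul hr hrp.nonneg hε.le, htop, ENNReal.mul_top (by simpa using hε)] at hle

theorem exists_lt_projection_le (τ : FNSTrace N) {r e : H →L[ℂ] H} (hr : r ∈ N)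
    (hrp : IsStarProjection r) (he : e ∈ N) (hep : IsStarProjection e) (hre : r < e)
    (hfin : τ.toFun r ≠ ∞) :
    ∃ s ∈ N, IsStarProjection s ∧ r < s ∧ s ≤ e ∧ τ.toFun s ≠ ∞ := by
  have hsub : IsStarProjection (e - r) := (hrp.le_iff_sub hep).mp hre.le
  obtain ⟨s, hs, hsp, hsne, hse, hsfin⟩ :=
    τ.exists_finite_subprojection (sub_mem he hr) hsub (sub_ne_zero.mpr hre.ne')
  have hrs : r * s = 0 := by
    rw [← (hsp.le_iff_mul_eq_right hsub).mp hse, ← mul_assoc, mul_sub,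
      (hrp.le_iff_mul_eq_left hep).mp hre.le, hrp.isIdempotentElem.eq, sub_self, zero_mul]
  refine ⟨r + s, add_mem hr hs, hrp.add hsp hrs,
    lt_add_of_pos_right r (hsp.nonneg.lt_of_ne hsne.symm), le_sub_iff_add_le'.mp hse, ?_⟩
  rw [τ.map_add r hr s hs hrp.nonneg hsp.nonneg]
  exact ENNReal.add_ne_top.mpr ⟨hfin, hsfin⟩

theorem exists_subprojection_trace_ge (τ : FNSTrace N) {e : H →L[ℂ] H} (he : e ∈ N)
    (hp : IsStarProjection e) (htop : τ.toFun e = ∞) {K : ℝ≥0∞} (hK : K ≠ ∞) :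
    ∃ r ∈ N, IsStarProjection r ∧ r ≤ e ∧ K ≤ τ.toFun r ∧ τ.toFun r ≠ ∞ := by
  by_contra! hcon
  let S : Set (H →L[ℂ] H) := {r | r ∈ N ∧ IsStarProjection r ∧ r ≤ e ∧ τ.toFun r ≤ K}
  obtain ⟨r, -, hmax⟩ := zorn_le_nonempty₀ S (fun c hcS hc y hy => by
    obtain ⟨P, hP, hPp, hlub⟩ := exists_isLUB_of_directedOn (N := N) ⟨y, hy⟩
      (fun p hp => ⟨(hcS hp).1, (hcS hp).2.1⟩) hc.directedOn
    refine ⟨P, ⟨hP, hPp, hlub.2 fun p hp => (hcS hp).2.2.1, ?_⟩, fun z hz => hlub.1 hz⟩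
    rw [τ.normal c ⟨y, hy⟩ (fun x hx => ⟨(hcS hx).1, (hcS hx).2.1.nonneg⟩) hc.directedOn P hP hlub]
    exact iSup₂_le fun x hx => (hcS hx).2.2.2) 0
    ⟨zero_mem N, .zero _, hp.nonneg, by simp [τ.map_zero]⟩
  obtain ⟨hr, hrp, hre, hrK⟩ := hmax.prop
  have hrfin : τ.toFun r ≠ ∞ := ne_top_of_le_ne_top hK hrK
  have hlt : r < e := hre.lt_of_ne (by rintro rfl; exact hrfin htop)
  obtain ⟨s, hs, hsp, hrs, hse, hsfin⟩ := τ.exists_lt_projection_le hr hrp he hp hlt hrfin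
  have hsK : τ.toFun s ≤ K := by
    by_contra! hlt
    exact hsfin (hcon s hs hsp hse hlt.le)
  exact hrs.not_ge (hmax.le_of_ge ⟨hs, hsp, hse, hsK⟩ hrs.le)

theorem exists_projection_ge_trace_sub_ge (τ : FNSTrace N) (hτ : τ.toFun 1 = ∞)
    {P : H →L[ℂ] H} (hP : P ∈ N) (hp : IsStarProjection P) (hfin : τ.toFun P ≠ ∞) (K : ℝ) :
    ∃ Q ∈ N, IsStarProjection Q ∧ P ≤ Q ∧ τ.toFun Q ≠ ∞ ∧ K ≤ (τ.toFun (Q - P)).toReal := by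
  have htop : τ.toFun (1 - P) = ∞ := by
    have hsum := τ.map_eq_add_map_sub hP (one_mem N) hp.nonneg hp.le_one
    rw [hτ] at hsum
    exact (ENNReal.add_eq_top.mp hsum.symm).resolve_left hfin
  obtain ⟨r, hr, hrp, hr1, hrK, hrfin⟩ := τ.exists_subprojection_trace_ge
    (sub_mem (one_mem N) hP) hp.one_sub htop (ENNReal.ofReal_ne_top (r := K))
  have hrP : r * P = 0 := by
    rw [← (hrp.le_iff_mul_eq_left hp.one_sub).mp hr1, mul_assoc, hp.one_sub_mul_self, mul_zero]
  refine ⟨r + P, add_mem hr hP, hrp.add hp hrP, le_add_of_nonneg_left hrp.nonneg, ?_, ?_⟩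
  · rw [τ.map_add r hr P hP hrp.nonneg hp.nonneg]
    exact ENNReal.add_ne_top.mpr ⟨hrfin, hfin⟩
  · rw [add_sub_cancel_right]
    exact (ENNReal.ofReal_le_iff_le_toReal hrfin).mp hrK

theorem exists_orthogonalProjections_trace_ge (τ : FNSTrace N) (hτ : τ.toFun 1 = ∞) {g : ℝ → ℝ}
    (hg : MonotoneOn g (Set.Ici 0)) :
    ∃ p : ℕ → H →L[ℂ] H, IsOrthogonalProjections p ∧ (∀ n, p n ∈ N) ∧
      (∀ n, τ.toFun (p n) ≠ ∞) ∧ g 0 ≤ (τ.toFun (p 0)).toReal ∧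
      ∀ n, g (τ.toFun (p n)).toReal ≤ (τ.toFun (p (n + 1))).toReal := by
  let F := {P : H →L[ℂ] H // P ∈ N ∧ IsStarProjection P ∧ τ.toFun P ≠ ∞}
  have hnext : ∀ P : F, ∃ Q : F, P.1 ≤ Q.1 ∧
      g (τ.toFun P.1).toReal ≤ (τ.toFun (Q.1 - P.1)).toReal := by
    rintro ⟨P, hP, hp, hfin⟩
    obtain ⟨Q, hQ, hq, hPQ, hqfin, hK⟩ := τ.exists_projection_ge_trace_sub_ge hτ hP hp hfin
      (g (τ.toFun P).toReal)
    exact ⟨⟨Q, hQ, hq, hqfin⟩, hPQ, hK⟩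
  choose next hle_next hg_next using hnext
  let P : ℕ → F := fun n => Nat.rec ⟨0, zero_mem N, .zero _, by simp [τ.map_zero]⟩ (fun _ => next) n
  have hmono : Monotone fun n => (P n).1 := monotone_nat_of_le_succ fun n => hle_next (P n)
  have horth := isOrthogonalProjections_sub_of_monotone (fun n => (P n).2.2.1) hmono
  have hmem : ∀ n, (P (n + 1)).1 - (P n).1 ∈ N := fun n => sub_mem (P (n + 1)).2.1 (P n).2.1
  have htrace_le : ∀ n, τ.toFun ((P (n + 1)).1 - (P n).1) ≤ τ.toFun (P (n + 1)).1 := fun n =>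
    τ.mono (hmem n) (P (n + 1)).2.1 (horth.isStarProjection n).nonneg
      (sub_le_self _ (P n).2.2.1.nonneg)
  refine ⟨_, horth, hmem, fun n => ne_top_of_le_ne_top (P (n + 1)).2.2.2 (htrace_le n), ?_,
    fun n => (hg ?_ ?_ ?_).trans (hg_next (P (n + 1)))⟩
  · simpa [P, τ.map_zero] using hg_next (P 0)
  · exact ENNReal.toReal_nonneg
  · exact ENNReal.toReal_nonneg
  · exact ENNReal.toReal_mono (P (n + 1)).2.2.2 (htrace_le n)

end FNSTrace

section Diagonal

/-- The operator with eigenvalue `b i` on the range of `p i` and `0` on the orthogonal complement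
of all these ranges, for mutually orthogonal projections `p i` and summable `b`. -/
noncomputable def diagonal {ι : Type*} (p : ι → H →L[ℂ] H) (b : ι → ℝ) : H →L[ℂ] H :=
  ∑' i, b i • p i

variable {ι : Type*} {p : ι → H →L[ℂ] H} {b : ι → ℝ}

namespace IsOrthogonalProjections

theorem norm_smul_le (hp : IsOrthogonalProjections p) (b : ι → ℝ) (i : ι) :
    ‖b i • p i‖ ≤ |b i| := by
  rw [norm_smul, Real.norm_eq_abs]
  exact mul_le_of_le_one_right (abs_nonneg _) (hp.isStarProjection i).norm_le

theorem summable_smul (hp : IsOrthogonalProjections p) (hb : Summable b) :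
    Summable fun i => b i • p i :=
  .of_norm_bounded hb.abs (hp.norm_smul_le b)

theorem diagonal_mem (hp : IsOrthogonalProjections p) (hmem : ∀ i, p i ∈ N) (hb : Summable b) :
    diagonal p b ∈ N :=
  (isClosed_vonNeumannAlgebra N).mem_of_tendsto (hp.summable_smul hb).hasSum
    (Eventually.of_forall fun _ => sum_mem fun i _ => real_smul_mem (hmem i) _)

theorem isSelfAdjoint_diagonal (hp : IsOrthogonalProjections p) (b : ι → ℝ) :
    IsSelfAdjoint (diagonal p b) := by
  rw [IsSelfAdjoint, diagonal, tsum_star]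
  exact tsum_congr fun i => by rw [star_smul, star_trivial, (hp.isStarProjection i).isSelfAdjoint]

theorem diagonal_nonneg (hp : IsOrthogonalProjections p) (hb : ∀ i, 0 ≤ b i) :
    0 ≤ diagonal p b :=
  tsum_nonneg fun i => smul_nonneg (hb i) (hp.isStarProjection i).nonneg

theorem diagonal_mul (hp : IsOrthogonalProjections p) (hb : Summable b) (i : ι) :
    diagonal p b * p i = b i • p i := by
  rw [diagonal, ← (hp.summable_smul hb).tsum_mul_right, tsum_eq_single i]
  · rw [smul_mul_assoc, (hp.isStarProjection i).isIdempotentElem.eq]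
  · intro j hj
    rw [smul_mul_assoc, hp.mul_eq_zero hj, smul_zero]

theorem diagonal_apply_eq_zero (hp : IsOrthogonalProjections p) (hb : Summable b) {v : H}
    (hv : ∀ i, p i v = 0) : diagonal p b v = 0 := by
  have happly := (hp.summable_smul hb).hasSum.mapL (ContinuousLinearMap.apply ℂ H v)
  simp only [ContinuousLinearMap.apply_apply, _root_.smul_apply, hv, smul_zero] at happly
  exact happly.unique hasSum_zero

theorem trace_diagonal (hp : IsOrthogonalProjections p) (hmem : ∀ i, p i ∈ N) (hb : Summable b)
    (hb0 : ∀ i, 0 ≤ b i) (τ : FNSTrace N) :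
    τ.toFun (diagonal p b) = ∑' i, ENNReal.ofReal (b i) * τ.toFun (p i) := by
  rw [diagonal, τ.map_tsum (fun i => real_smul_mem (hmem i) _)
    (fun i => smul_nonneg (hb0 i) (hp.isStarProjection i).nonneg) (hp.summable_smul hb)]
  exact tsum_congr fun i => τ.map_real_smul (hmem i) (hp.isStarProjection i).nonneg (hb0 i)

theorem apply_eq_zero_of_mem_orthogonal (hp : IsOrthogonalProjections p) {v : H}
    (hv : v ∈ (⨆ i, (p i).range).topologicalClosureᗮ) (i : ι) : p i v = 0 := by
  have hmem : p i (p i v) ∈ (⨆ i, (p i).range).topologicalClosure :=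
    Submodule.le_topologicalClosure _ (Submodule.mem_iSup_of_mem i ⟨p i v, rfl⟩)
  have hsymm : inner ℂ (p i (p i v)) v = inner ℂ (p i v) (p i v) :=
    (hp.isStarProjection i).isSelfAdjoint.isSymmetric (p i v) v
  rw [← inner_self_eq_zero (𝕜 := ℂ), ← hsymm]
  exact Submodule.inner_right_of_mem_orthogonal hmem hv

theorem eq_zero_of_mul_eq_zero (hp : IsOrthogonalProjections p) {X : H →L[ℂ] H}
    (hX : ∀ i, X * p i = 0) (hX' : ∀ v, (∀ i, p i v = 0) → X v = 0) : X = 0 := by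
  set K := (⨆ i, (p i).range).topologicalClosure
  have : CompleteSpace K := (Submodule.isClosed_topologicalClosure _).completeSpace_coe
  have hK : K ≤ X.ker := by
    refine Submodule.topologicalClosure_minimal _ (iSup_le fun i => ?_)
      (ContinuousLinearMap.isClosed_ker X)
    rintro _ ⟨v, rfl⟩
    exact DFunLike.congr_fun (hX i) v
  ext v
  have hKv : X (K.starProjection v) = 0 := hK (Submodule.starProjection_apply_mem K v)
  have hKv' : X (Kᗮ.starProjection v) = 0 :=
    hX' _ (hp.apply_eq_zero_of_mem_orthogonal (Submodule.starProjection_apply_mem Kᗮ v))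
  conv_lhs => rw [← Submodule.starProjection_add_starProjection_orthogonal (K := K) v]
  rw [map_add, hKv, hKv', add_zero, _root_.zero_apply]

end IsOrthogonalProjections

theorem aeval_apply_eq_smul {E : Type*} [NormedAddCommGroup E] [NormedSpace ℂ E]
    {A : E →L[ℂ] E} {a : ℝ} {x : E} (h : A x = a • x)
    (P : Polynomial ℝ) : Polynomial.aeval A P x = P.eval a • x := by
  have hpow : ∀ n : ℕ, (A ^ n) x = a ^ n • x := by
    intro n
    induction n with
    | zero => simp
    | succ n ih =>
      rw [pow_succ', mul_apply_eq_comp, ih, map_real_smul A A.continuous, h, smul_smul,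
        pow_succ]
  induction P using Polynomial.induction_on' with
  | add P Q hP hQ => simp [hP, hQ, add_smul]
  | monomial n c =>
    simp [Polynomial.aeval_monomial, Algebra.algebraMap_eq_smul_one, hpow, smul_smul]

theorem exists_polynomial_near_of_isCompact {K : Set ℝ} (hK : IsCompact K) {f : ℝ → ℝ}
    (hf : Continuous f) {ε : ℝ} (hε : 0 < ε) :
    ∃ P : Polynomial ℝ, ∀ x ∈ K, |P.eval x - f x| < ε := by
  obtain ⟨R, hR⟩ := hK.isBounded.subset_closedBall 0
  obtain ⟨P, hP⟩ := exists_polynomial_near_of_continuousOn (-R) R f hf.continuousOn ε hε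
  refine ⟨P, fun x hx => hP x ?_⟩
  simpa [Real.closedBall_eq_Icc] using hR hx

theorem cfc_apply_eq_smul {A : H →L[ℂ] H} (hA : IsSelfAdjoint A) {a : ℝ} {x : H}
    (h : A x = a • x) {f : ℝ → ℝ} (hf : Continuous f) : cfc f A x = f a • x := by
  have hbound : ∀ δ : ℝ, 0 < δ → ‖cfc f A x - f a • x‖ ≤ δ * (2 * ‖x‖) := by
    intro δ hδ
    obtain ⟨P, hP⟩ := exists_polynomial_near_of_isCompact
      ((ContinuousFunctionalCalculus.isCompact_spectrum (R := ℝ) A).insert a) hf hδ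
    have hop : ‖cfc f A - Polynomial.aeval A P‖ ≤ δ := by
      rw [← cfc_polynomial P A, ← cfc_sub ..]
      refine norm_cfc_le hδ.le fun x hx => ?_
      rw [Real.norm_eq_abs, abs_sub_comm]
      exact (hP x (Set.mem_insert_of_mem _ hx)).le
    calc ‖cfc f A x - f a • x‖
        = ‖(cfc f A - Polynomial.aeval A P) x + (P.eval a - f a) • x‖ := by
          rw [_root_.sub_apply, aeval_apply_eq_smul h, sub_smul, sub_add_sub_cancel]
      _ ≤ δ * ‖x‖ + δ * ‖x‖ := by
          refine (norm_add_le _ _).trans (add_le_add ?_ ?_)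
          · exact (ContinuousLinearMap.le_opNorm _ _).trans (by gcongr)
          · rw [norm_smul]
            gcongr
            exact (hP a (Set.mem_insert _ _)).le
      _ = δ * (2 * ‖x‖) := by ring
  have hlim : Tendsto (fun δ : ℝ => δ * (2 * ‖x‖)) (𝓝[>] 0) (𝓝 (0 * (2 * ‖x‖))) :=
    ((continuous_mul_const _).tendsto 0).mono_left nhdsWithin_le_nhds
  have hzero := ge_of_tendsto hlim (eventually_mem_nhdsWithin.mono hbound)
  rw [zero_mul] at hzero
  exact sub_eq_zero.mp (norm_le_zero_iff.mp hzero)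

theorem IsOrthogonalProjections.cfc_diagonal (hp : IsOrthogonalProjections p) (hb : Summable b)
    {f : ℝ → ℝ} (hf : Continuous f) (hf0 : f 0 = 0) (hfb : Summable fun i => f (b i)) :
    cfc f (diagonal p b) = diagonal p fun i => f (b i) := by
  have hsa := hp.isSelfAdjoint_diagonal b
  refine sub_eq_zero.mp (hp.eq_zero_of_mul_eq_zero (fun i => ?_) fun v hv => ?_)
  · rw [sub_mul, hp.diagonal_mul hfb, sub_eq_zero]
    ext v
    exact cfc_apply_eq_smul hsa (DFunLike.congr_fun (hp.diagonal_mul hb i) v) hf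
  · have hAv : diagonal p b v = (0 : ℝ) • v := by rw [zero_smul, hp.diagonal_apply_eq_zero hb hv]
    rw [_root_.sub_apply, cfc_apply_eq_smul hsa hAv hf, hf0, zero_smul,
      hp.diagonal_apply_eq_zero hfb hv, sub_zero]

end Diagonal

section Tail

variable {p : ℕ → H →L[ℂ] H} {b : ℕ → ℝ}

theorem IsOrthogonalProjections.isStarProjection_sum_range (hp : IsOrthogonalProjections p)
    (m : ℕ) : IsStarProjection (∑ k ∈ Finset.range m, p k) := by
  induction m with
  | zero => simp [IsStarProjection.zero]
  | succ m ih =>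
    rw [Finset.sum_range_succ]
    refine ih.add (hp.isStarProjection m) ?_
    rw [Finset.sum_mul]
    exact Finset.sum_eq_zero fun k hk => hp.mul_eq_zero (Finset.mem_range.mp hk).ne

theorem IsOrthogonalProjections.norm_diagonal_mul_one_sub_sum_le (hp : IsOrthogonalProjections p)
    (hb : Summable b) (hb0 : ∀ n, 0 ≤ b n) (m : ℕ) :
    ‖diagonal p b * (1 - ∑ k ∈ Finset.range m, p k)‖ ≤ ∑' k, b (k + m) := by
  have htail : diagonal p b * (1 - ∑ k ∈ Finset.range m, p k) = ∑' k, b (k + m) • p (k + m) := by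
    rw [mul_sub, mul_one, Finset.mul_sum, Finset.sum_congr rfl fun k _ => hp.diagonal_mul hb k,
      diagonal, ← (hp.summable_smul hb).sum_add_tsum_nat_add m, add_sub_cancel_left]
  rw [htail]
  exact tsum_of_norm_bounded ((summable_nat_add_iff m).mpr hb).hasSum fun k =>
    (hp.norm_smul_le b (k + m)).trans_eq (abs_of_nonneg (hb0 _))

end Tail

section SingularValue

theorem singularValue_nonneg (τ : FNSTrace N) (A : H →L[ℂ] H) (s : ℝ) :
    0 ≤ singularValue τ A s := by
  refine Real.sInf_nonneg ?_
  rintro _ ⟨p, -, -, -, rfl⟩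
  exact norm_nonneg _

theorem singularValue_le (τ : FNSTrace N) (A : H →L[ℂ] H) {p : H →L[ℂ] H} (hp : p ∈ N)
    (hpp : IsStarProjection p) {s : ℝ} (hs : τ.toFun (1 - p) ≤ ENNReal.ofReal s) :
    singularValue τ A s ≤ ‖A * p‖ := by
  refine csInf_le ⟨0, ?_⟩ ⟨p, hp, hpp, hs, rfl⟩
  rintro _ ⟨p, -, -, -, rfl⟩
  exact norm_nonneg _

theorem singularValue_antitone (τ : FNSTrace N) (A : H →L[ℂ] H) :
    Antitone (singularValue τ A) := by
  intro s t hst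
  refine le_csInf ⟨‖A * 1‖, 1, one_mem N, .one _, by simp [τ.map_zero], rfl⟩ ?_
  rintro _ ⟨p, hp, hpp, hps, rfl⟩
  exact singularValue_le τ A hp hpp (hps.trans (ENNReal.ofReal_le_ofReal hst))

theorem dixmierMean_nonneg (τ : FNSTrace N) (A : H →L[ℂ] H) {t : ℝ} (ht : 0 < t) :
    0 ≤ dixmierMean τ A t :=
  mul_nonneg (one_div_nonneg.mpr (Real.log_nonneg (by linarith)))
    (intervalIntegral.integral_nonneg ht.le fun s _ => singularValue_nonneg τ A s)

theorem memLp_dixmierMean (τ : FNSTrace N) (A : H →L[ℂ] H) {C : ℝ}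
    (hC : ∀ t, 0 < t → dixmierMean τ A t ≤ C) : MemLp (dixmierMean τ A) ∞ halfLine := by
  have hint : Continuous fun t => ∫ s in (0 : ℝ)..t, singularValue τ A s :=
    intervalIntegral.continuous_primitive
      (fun _ _ => (singularValue_antitone τ A).intervalIntegrable) 0
  have hlog : Measurable fun t : ℝ => 1 / Real.log (1 + t) := by fun_prop
  refine memLp_top_of_bound (hlog.mul hint.measurable).aestronglyMeasurable C ?_
  rw [halfLine, ae_restrict_iff' measurableSet_Ioi]
  refine Eventually.of_forall fun t ht => ?_
  rw [Real.norm_of_nonneg (dixmierMean_nonneg τ A ht)]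
  exact hC t ht

end SingularValue

theorem integral_indicator_Iio_le {D c t : ℝ} (ht : 0 ≤ t) (hD : 0 ≤ D) (hc : 0 ≤ c) :
    ∫ s in (0 : ℝ)..t, (Set.Iio D).indicator (fun _ => c) s ≤ D * c := by
  rw [intervalIntegral.integral_of_le ht, setIntegral_indicator measurableSet_Iio,
    setIntegral_const, smul_eq_mul]
  gcongr
  calc volume.real (Set.Ioc 0 t ∩ Set.Iio D) ≤ volume.real (Set.Ioc 0 D) :=
        measureReal_mono (fun s hs => ⟨hs.1.1, hs.2.le⟩) measure_Ioc_lt_top.ne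
    _ = D := by rw [Real.volume_real_Ioc_of_le hD, sub_zero]

/-- Discrete spectral data for the positive operator `diagonal p b` in `N`: its eigenvalue on the
range of `p n` is `b n`, with multiplicity `d n = τ (p n)`. Neither distinctness nor an ordering of
the eigenvalues is imposed; summability of `d n * b n ^ 2` makes the heat traces finite. -/
structure IsSpectralData (τ : FNSTrace N) (p : ℕ → H →L[ℂ] H) (b d : ℕ → ℝ) : Prop
    extends IsOrthogonalProjections p where
  mem : ∀ n, p n ∈ N
  trace_eq : ∀ n, τ.toFun (p n) = ENNReal.ofReal (d n)
  eigenvalue_nonneg : ∀ n, 0 ≤ b n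
  trace_nonneg : ∀ n, 0 ≤ d n
  summable_eigenvalue : Summable b
  summable_trace_mul_sq : Summable fun n => d n * b n ^ 2

namespace IsSpectralData

variable {τ : FNSTrace N} {p : ℕ → H →L[ℂ] H} {b d : ℕ → ℝ} (h : IsSpectralData τ p b d)
include h

theorem singularValue_le_tail {m : ℕ} {s : ℝ} (hs : ∑ k ∈ Finset.range m, d k ≤ s) :
    singularValue τ (diagonal p b) s ≤ ∑' k, b (k + m) := by
  have hmem : ∑ k ∈ Finset.range m, p k ∈ N := sum_mem fun k _ => h.mem k
  refine (singularValue_le τ _ (sub_mem (one_mem N) hmem)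
    (h.isStarProjection_sum_range m).one_sub ?_).trans
    (h.norm_diagonal_mul_one_sub_sum_le h.summable_eigenvalue h.eigenvalue_nonneg m)
  rw [sub_sub_cancel, τ.map_sum _ h.mem
    fun k => (h.isStarProjection k).nonneg, Finset.sum_congr rfl fun k _ => h.trace_eq k,
    ← ENNReal.ofReal_sum_of_nonneg fun k _ => h.trace_nonneg k]
  exact ENNReal.ofReal_le_ofReal hs

theorem singularValue_le_sum_indicator_add_tail (m : ℕ) {s : ℝ} (hs : 0 ≤ s) :
    singularValue τ (diagonal p b) s ≤ ∑ k ∈ Finset.range m,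
      (Set.Iio (∑ j ∈ Finset.range (k + 1), d j)).indicator (fun _ => b k) s +
        ∑' k, b (k + m) := by
  induction m with
  | zero => simpa using h.singularValue_le_tail (m := 0) (by simpa using hs)
  | succ m ih =>
    by_cases hsm : s < ∑ j ∈ Finset.range (m + 1), d j
    · have htail : ∑' k, b (k + m) = b m + ∑' k, b (k + (m + 1)) := by
        rw [((summable_nat_add_iff m).mpr h.summable_eigenvalue).tsum_eq_zero_add, zero_add]
        simp only [Nat.add_right_comm, Nat.add_assoc]
      rw [Finset.sum_range_succ, Set.indicator_of_mem (Set.mem_Iio.mpr hsm), add_assoc, ← htail]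
      exact ih
    · refine (h.singularValue_le_tail (not_lt.mp hsm)).trans (le_add_of_nonneg_left ?_)
      exact Finset.sum_nonneg fun k _ => Set.indicator_nonneg (fun _ _ => h.eigenvalue_nonneg k) s

theorem integral_singularValue_le (m : ℕ) {t : ℝ} (ht : 0 ≤ t) :
    ∫ s in (0 : ℝ)..t, singularValue τ (diagonal p b) s ≤
      ∑ k ∈ Finset.range m, (∑ j ∈ Finset.range (k + 1), d j) * b k + t * ∑' k, b (k + m) := by
  have hint : ∀ k ∈ Finset.range m, IntervalIntegrable
      ((Set.Iio (∑ j ∈ Finset.range (k + 1), d j)).indicator fun _ => b k) volume 0 t :=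
    fun k _ => (intervalIntegrable_iff_integrableOn_Ioc_of_le ht).mpr
      ((integrable_const (b k)).indicator measurableSet_Iio)
  have hsum : IntervalIntegrable (fun s => ∑ k ∈ Finset.range m,
      (Set.Iio (∑ j ∈ Finset.range (k + 1), d j)).indicator (fun _ => b k) s) volume 0 t := by
    simpa only [Finset.sum_fn] using IntervalIntegrable.sum _ hint
  calc ∫ s in (0 : ℝ)..t, singularValue τ (diagonal p b) s
      ≤ ∫ s in (0 : ℝ)..t, (∑ k ∈ Finset.range m,
          (Set.Iio (∑ j ∈ Finset.range (k + 1), d j)).indicator (fun _ => b k) s +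
            ∑' k, b (k + m)) :=
        intervalIntegral.integral_mono_on ht (singularValue_antitone τ _).intervalIntegrable
          (hsum.add intervalIntegrable_const)
          fun s hs => h.singularValue_le_sum_indicator_add_tail m hs.1
    _ = (∑ k ∈ Finset.range m, ∫ s in (0 : ℝ)..t,
          (Set.Iio (∑ j ∈ Finset.range (k + 1), d j)).indicator (fun _ => b k) s) +
            t * ∑' k, b (k + m) := by
        rw [intervalIntegral.integral_add hsum intervalIntegrable_const,
          intervalIntegral.integral_finsetSum hint, intervalIntegral.integral_const, sub_zero,
          smul_eq_mul]
    _ ≤ _ := by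
        gcongr with k
        exact integral_indicator_Iio_le ht (Finset.sum_nonneg fun j _ => h.trace_nonneg j)
          (h.eigenvalue_nonneg k)

end IsSpectralData

section Cesaro

variable {x : ℝ → ℝ} {V : ℝ}

theorem integrableOn_div_self (hx : AEMeasurable x halfLine)
    (hV : ∀ s, 0 < s → |x s / s| ≤ V) {S : Set ℝ} (hS : S ⊆ Set.Ioi 0)
    (hSm : MeasurableSet S) (hfin : volume S ≠ ∞) : IntegrableOn (fun s => x s / s) S := by
  have : IsFiniteMeasure (volume.restrict S) := ⟨by simpa using hfin.lt_top⟩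
  have hmeas : AEMeasurable (fun s => x s / s) (volume.restrict S) :=
    (hx.mono_measure (Measure.restrict_mono hS le_rfl)).div aemeasurable_id
  refine Integrable.of_bound hmeas.aestronglyMeasurable V ?_
  rw [ae_restrict_iff' hSm]
  exact Eventually.of_forall fun s hs => hV s (hS hs)

theorem intervalIntegrable_div_self (hx : AEMeasurable x halfLine)
    (hV : ∀ s, 0 < s → |x s / s| ≤ V) {a b : ℝ} (ha : 0 < a) (hb : 0 < b) :
    IntervalIntegrable (fun s => x s / s) volume a b := by
  rw [intervalIntegrable_iff]
  exact integrableOn_div_self hx hV (fun t ht => (lt_min ha hb).trans ht.1) measurableSet_uIoc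
    (by simp)

theorem locallyIntegrableOn_of_abs_div_self_le (hx : AEMeasurable x halfLine)
    (hV : ∀ s, 0 < s → |x s / s| ≤ V) : LocallyIntegrableOn x (Set.Ioi 0) := by
  rw [locallyIntegrableOn_iff isOpen_Ioi.isLocallyClosed]
  intro K hK hKc
  have hdiv := integrableOn_div_self hx hV hK hKc.measurableSet hKc.measure_lt_top.ne
  exact (hdiv.mul_continuousOn continuousOn_id hKc).congr_fun
    (fun s hs => div_mul_cancel₀ _ (ne_of_gt (hK hs))) hKc.measurableSet

theorem aestronglyMeasurable_cesaro (hx : AEMeasurable x halfLine)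
    (hV : ∀ s, 0 < s → |x s / s| ≤ V) : AEStronglyMeasurable (cesaro x) halfLine := by
  have hint : ContinuousOn (fun T => ∫ s in (1 : ℝ)..T, x s / s) (Set.Ioi 0) := by
    intro T (hT : 0 < T)
    refine (intervalIntegral.continuousOn_primitive_interval' (a := 1) (b₁ := min 1 (T / 2))
      (b₂ := max 1 (2 * T)) (intervalIntegrable_div_self hx hV (by positivity) (by positivity))
      ?_).continuousAt ?_ |>.continuousWithinAt
    · rw [Set.uIcc_of_le (by simp)]
      simp
    · rw [Set.uIcc_of_le (by simp)]
      exact Icc_mem_nhds (min_lt_of_right_lt (by linarith)) (lt_max_of_lt_right (by linarith))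
  have hlog : Measurable fun T : ℝ => 1 / Real.log T := by fun_prop
  exact (hlog.aemeasurable.mul (hint.aemeasurable measurableSet_Ioi)).aestronglyMeasurable

theorem abs_sub_one_le_two_mul_abs_log {T : ℝ} (hT : 0 < T) (hT2 : T ≤ 2) :
    |T - 1| ≤ 2 * |Real.log T| := by
  rcases le_total T 1 with h1 | h1
  · rw [abs_of_nonpos (by linarith), abs_of_nonpos (Real.log_nonpos hT.le h1)]
    linarith [Real.log_le_sub_one_of_pos hT]
  · rw [abs_of_nonneg (by linarith), abs_of_nonneg (Real.log_nonneg h1)]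
    calc T - 1 = T * (1 - T⁻¹) := by field_simp
      _ ≤ T * Real.log T := by gcongr; exact Real.one_sub_inv_le_log_of_pos hT
      _ ≤ 2 * Real.log T := by gcongr; exact Real.log_nonneg h1

theorem log_one_add_le_two_mul_log {T : ℝ} (hT : 2 ≤ T) :
    Real.log (1 + T) ≤ 2 * Real.log T := by
  rw [← Real.log_rpow (by linarith), Real.rpow_two]
  exact Real.log_le_log (by linarith) (by nlinarith)

theorem abs_cesaro_le_of_le_two (hV : ∀ s, 0 < s → |x s / s| ≤ V) {T : ℝ}
    (hT : 0 < T) (hT2 : T ≤ 2) : |cesaro x T| ≤ 2 * V := by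
  have hV0 : 0 ≤ V := (abs_nonneg _).trans (hV 1 one_pos)
  have hint : ‖∫ s in (1 : ℝ)..T, x s / s‖ ≤ V * |T - 1| :=
    intervalIntegral.norm_integral_le_of_norm_le_const fun s hs =>
      hV s ((lt_min one_pos hT).trans hs.1)
  rw [cesaro, abs_mul, abs_div, abs_one, one_div, inv_mul_eq_div]
  refine div_le_of_le_mul₀ (abs_nonneg _) (by positivity) (hint.trans ?_)
  calc V * |T - 1| ≤ V * (2 * |Real.log T|) := by
        gcongr
        exact abs_sub_one_le_two_mul_abs_log hT hT2
    _ = 2 * V * |Real.log T| := by ring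

theorem abs_cesaro_le_of_two_le {C : ℝ} {T : ℝ} (hT : 2 ≤ T)
    (hC : |∫ s in (1 : ℝ)..T, x s / s| ≤ C * Real.log (1 + T)) : |cesaro x T| ≤ 2 * C := by
  have hlog : 0 < Real.log T := Real.log_pos (by linarith)
  have hC0 : 0 ≤ C :=
    nonneg_of_mul_nonneg_left ((abs_nonneg _).trans hC) (Real.log_pos (by linarith))
  rw [cesaro, abs_mul, abs_div, abs_one, one_div, inv_mul_eq_div, abs_of_pos hlog,
    div_le_iff₀ hlog]
  calc |∫ s in (1 : ℝ)..T, x s / s| ≤ C * Real.log (1 + T) := hC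
    _ ≤ C * (2 * Real.log T) := by gcongr; exact log_one_add_le_two_mul_log hT
    _ = 2 * C * Real.log T := by ring

theorem memLp_cesaro {C : ℝ} (hx : AEMeasurable x halfLine)
    (hV : ∀ s, 0 < s → |x s / s| ≤ V)
    (hC : ∀ T, 1 ≤ T → |∫ s in (1 : ℝ)..T, x s / s| ≤ C * Real.log (1 + T)) :
    MemLp (cesaro x) ∞ halfLine := by
  refine memLp_top_of_bound (aestronglyMeasurable_cesaro hx hV) (max (2 * V) (2 * C)) ?_
  rw [halfLine, ae_restrict_iff' measurableSet_Ioi]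
  refine Eventually.of_forall fun T hT => ?_
  rcases le_total T 2 with h2 | h2
  · exact (abs_cesaro_le_of_le_two hV hT h2).trans (le_max_left _ _)
  · exact (abs_cesaro_le_of_two_le h2 (hC T (by linarith))).trans (le_max_right _ _)

theorem mul_div_log_le_cesaro (hx : AEMeasurable x halfLine)
    (hV : ∀ s, 0 < s → |x s / s| ≤ V) (h0 : ∀ s, 0 < s → 0 ≤ x s / s) {a c T : ℝ} (ha : 1 ≤ a)
    (hc : ∀ s ∈ Set.Icc a (2 * a), c ≤ x s / s) (hT : 2 * a ≤ T) :
    a * c / Real.log T ≤ cesaro x T := by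
  have ha0 : 0 < a := by linarith
  have hwindow : a * c ≤ ∫ s in a..2 * a, x s / s :=
    calc a * c = ∫ _ in a..2 * a, c := by
          rw [intervalIntegral.integral_const, smul_eq_mul]; ring
      _ ≤ _ := intervalIntegral.integral_mono_on (by linarith) intervalIntegrable_const
          (intervalIntegrable_div_self hx hV ha0 (by linarith)) hc
  have hsub : ∫ s in a..2 * a, x s / s ≤ ∫ s in (1 : ℝ)..T, x s / s := by
    refine intervalIntegral.integral_mono_interval ha (by linarith) hT ?_
      (intervalIntegrable_div_self hx hV one_pos (by linarith))
    filter_upwards [ae_restrict_mem measurableSet_Ioc] with s hs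
    exact h0 s (one_pos.trans hs.1)
  rw [cesaro, one_div, inv_mul_eq_div]
  gcongr
  · exact Real.log_nonneg (by linarith)
  · exact hwindow.trans hsub

end Cesaro

section HeatProfile

theorem exp_neg_rpow_neg_le_factorial_mul_sq {q x : ℝ} (hq : 0 < q) (hx : 0 < x) (hx1 : x ≤ 1) :
    Real.exp (-x ^ (-q)) ≤ (⌈2 / q⌉₊).factorial * x ^ 2 := by
  set m := ⌈2 / q⌉₊
  have hpos : 0 < x ^ (-q) := Real.rpow_pos_of_pos hx _
  have hone : 1 ≤ x ^ (-q) := Real.one_le_rpow_of_pos_of_le_one_of_nonpos hx hx1 (by linarith)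
  have hsq : (x ^ 2)⁻¹ ≤ Real.exp (x ^ (-q)) * m.factorial :=
    calc (x ^ 2)⁻¹ = (x ^ (-q)) ^ (2 / q) := by
          rw [← Real.rpow_mul hx.le, show -q * (2 / q) = -(2 : ℝ) by field_simp,
            Real.rpow_neg hx.le, Real.rpow_two]
      _ ≤ (x ^ (-q)) ^ m := by
          rw [← Real.rpow_natCast]
          exact Real.rpow_le_rpow_of_exponent_le hone (Nat.le_ceil _)
      _ ≤ Real.exp (x ^ (-q)) * m.factorial :=
          (div_le_iff₀ (by positivity)).mp (Real.pow_div_factorial_le_exp _ hpos.le m)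
  rw [inv_le_iff_one_le_mul₀ (by positivity)] at hsq
  rw [Real.exp_neg, inv_le_iff_one_le_mul₀ (Real.exp_pos _)]
  linarith

theorem exists_exp_neg_rpow_neg_le {q : ℝ} (hq : 0 < q) :
    ∃ C : ℝ, 0 < C ∧ ∀ x : ℝ, 0 < x → Real.exp (-x ^ (-q)) ≤ C * (x ^ 2 / (1 + x ^ 2)) := by
  obtain ⟨M, hM, hle⟩ : ∃ M : ℝ, 1 ≤ M ∧ ∀ x, 0 < x → x ≤ 1 → Real.exp (-x ^ (-q)) ≤ M * x ^ 2 :=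
    ⟨_, by exact_mod_cast Nat.factorial_pos _,
      fun _ => exp_neg_rpow_neg_le_factorial_mul_sq hq⟩
  refine ⟨2 * M, by positivity, fun x hx => ?_⟩
  rw [mul_div_assoc', le_div_iff₀ (by positivity)]
  rcases le_total 1 x with h1 | h1
  · have hle : Real.exp (-x ^ (-q)) ≤ 1 :=
      Real.exp_le_one_iff.mpr (neg_nonpos.mpr (Real.rpow_nonneg hx.le _))
    nlinarith
  · calc _ ≤ M * x ^ 2 * 2 := by
          gcongr
          · exact hle x hx h1
          · nlinarith
      _ = 2 * M * x ^ 2 := by ring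

theorem heatProfile_of_pos (q t : ℝ) {u : ℝ} (hu : 0 < u) :
    heatProfile q t u = Real.exp (-(t * u) ^ (-q)) := if_neg hu.not_ge

theorem heatProfile_of_nonpos (q t : ℝ) {u : ℝ} (hu : u ≤ 0) : heatProfile q t u = 0 :=
  if_pos hu

theorem heatProfile_nonneg (q t u : ℝ) : 0 ≤ heatProfile q t u := by
  rw [heatProfile]
  split_ifs
  exacts [le_rfl, (Real.exp_pos _).le]

theorem heatProfile_mono {q s t : ℝ} (hq : 0 < q) (hs : 0 < s) (hst : s ≤ t) (u : ℝ) :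
    heatProfile q s u ≤ heatProfile q t u := by
  rcases le_or_gt u 0 with hu | hu
  · rw [heatProfile_of_nonpos q s hu, heatProfile_of_nonpos q t hu]
  · rw [heatProfile_of_pos q s hu, heatProfile_of_pos q t hu]
    refine Real.exp_le_exp.mpr (neg_le_neg ?_)
    exact Real.rpow_le_rpow_of_nonpos (mul_pos hs hu) (by gcongr) (by linarith)

theorem exp_neg_one_le_heatProfile {q t u : ℝ} (hq : 0 < q) (hu : 0 < u) (htu : 1 ≤ t * u) :
    Real.exp (-1) ≤ heatProfile q t u := by
  rw [heatProfile_of_pos q t hu]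
  exact Real.exp_le_exp.mpr (neg_le_neg (Real.rpow_le_one_of_one_le_of_nonpos htu (by linarith)))

theorem exists_heatProfile_le {q : ℝ} (hq : 0 < q) :
    ∃ C : ℝ, 0 < C ∧ ∀ t u : ℝ, 0 < t →
      heatProfile q t u ≤ C * ((t * u) ^ 2 / (1 + (t * u) ^ 2)) := by
  obtain ⟨C, hC, hexp⟩ := exists_exp_neg_rpow_neg_le hq
  refine ⟨C, hC, fun t u ht => ?_⟩
  rcases le_or_gt u 0 with hu | hu
  · rw [heatProfile_of_nonpos q t hu]
    positivity
  · rw [heatProfile_of_pos q t hu]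
    exact hexp _ (mul_pos ht hu)

theorem exists_heatProfile_le_abs {q t : ℝ} (hq : 0 < q) (ht : 0 < t) :
    ∃ C : ℝ, ∀ u, heatProfile q t u ≤ C * |u| := by
  obtain ⟨C, hC, hle⟩ := exists_heatProfile_le hq
  refine ⟨C * t, fun u => (hle t u ht).trans ?_⟩
  rw [mul_assoc, ← abs_of_pos ht, ← abs_mul, abs_of_pos ht, ← sq_abs (t * u)]
  gcongr
  rw [div_le_iff₀ (by positivity)]
  nlinarith [abs_nonneg (t * u), mul_nonneg (abs_nonneg (t * u)) (sq_nonneg (|t * u| - 1))]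

theorem continuous_heatProfile {q t : ℝ} (hq : 0 < q) (ht : 0 < t) :
    Continuous (heatProfile q t) := by
  rw [continuous_iff_continuousAt]
  intro u
  rcases lt_trichotomy u 0 with hu | rfl | hu
  · refine continuousAt_const.congr (f := fun _ => (0 : ℝ)) ?_
    filter_upwards [gt_mem_nhds hu] with v hv using (heatProfile_of_nonpos q t hv.le).symm
  · obtain ⟨C, hC⟩ := exists_heatProfile_le_abs hq ht
    rw [ContinuousAt, heatProfile_of_nonpos q t le_rfl]
    refine squeeze_zero (heatProfile_nonneg q t) hC ?_
    have hcont : Continuous fun u : ℝ => C * |u| := by fun_prop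
    simpa using hcont.tendsto 0
  · have hc : ContinuousAt (fun v : ℝ => Real.exp (-(t * v) ^ (-q))) u := by
      refine Real.continuous_exp.continuousAt.comp (ContinuousAt.neg ?_)
      exact (continuousAt_const.mul continuousAt_id).rpow_const (Or.inl (mul_pos ht hu).ne')
    refine hc.congr ?_
    filter_upwards [lt_mem_nhds hu] with v hv using (heatProfile_of_pos q t hv).symm

theorem integral_div_one_add_sq_le (b : ℝ) {T : ℝ} (hb : 0 ≤ b) :
    ∫ s in (1 : ℝ)..T, b / (1 + (b * s) ^ 2) ≤ 2 := by
  have hderiv : ∀ s : ℝ, HasDerivAt (fun s => Real.arctan (b * s)) (b / (1 + (b * s) ^ 2)) s := by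
    intro s
    have hlin : HasDerivAt (fun s : ℝ => b * s) b s := by
      simpa using (hasDerivAt_id s).const_mul b
    exact hlin.arctan.congr_deriv (by ring)
  have hcont : Continuous fun s : ℝ => b / (1 + (b * s) ^ 2) := by
    refine Continuous.div (by fun_prop) (by fun_prop) fun s => ?_
    positivity
  rw [intervalIntegral.integral_eq_sub_of_hasDerivAt (fun s _ => hderiv s)
    (hcont.intervalIntegrable _ _)]
  have hlow : 0 ≤ Real.arctan (b * 1) := Real.arctan_nonneg.mpr (by linarith)
  linarith [Real.arctan_lt_pi_div_two (b * T), Real.pi_le_four]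

end HeatProfile

namespace IsSpectralData

variable {τ : FNSTrace N} {p : ℕ → H →L[ℂ] H} {b d : ℕ → ℝ} {q : ℝ} (h : IsSpectralData τ p b d)
include h

theorem summable_heatProfile_mul_trace (hq : 0 < q) {t : ℝ} (ht : 0 < t) :
    Summable fun n => heatProfile q t (b n) * d n := by
  obtain ⟨C, hC, hle⟩ := exists_heatProfile_le hq
  refine .of_nonneg_of_le (fun n => mul_nonneg (heatProfile_nonneg _ _ _) (h.trace_nonneg n))
    (fun n => ?_) (h.summable_trace_mul_sq.mul_left (C * t ^ 2))
  have hd := h.trace_nonneg n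
  calc heatProfile q t (b n) * d n ≤ C * (t * b n) ^ 2 * d n := by
        gcongr
        refine (hle t (b n) ht).trans ?_
        gcongr
        exact div_le_self (sq_nonneg _) (by nlinarith [sq_nonneg (t * b n)])
    _ = C * t ^ 2 * (d n * b n ^ 2) := by ring

theorem trace_heatOperator (hq : 0 < q) {t : ℝ} (ht : 0 < t) :
    τ.toFun (heatOperator q (diagonal p b) t) =
      ENNReal.ofReal (∑' n, heatProfile q t (b n) * d n) := by
  obtain ⟨C, hC⟩ := exists_heatProfile_le_abs hq ht
  have hsum : Summable fun n => heatProfile q t (b n) :=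
    .of_nonneg_of_le (fun n => heatProfile_nonneg _ _ _) (fun n => hC (b n))
      (h.summable_eigenvalue.abs.mul_left C)
  rw [heatOperator, h.cfc_diagonal h.summable_eigenvalue (continuous_heatProfile hq ht)
    (heatProfile_of_nonpos q t le_rfl) hsum, h.trace_diagonal h.mem hsum
    (fun n => heatProfile_nonneg _ _ _), ENNReal.ofReal_tsum_of_nonneg
      (fun n => mul_nonneg (heatProfile_nonneg _ _ _) (h.trace_nonneg n))
      (h.summable_heatProfile_mul_trace hq ht)]
  exact tsum_congr fun n => by rw [h.trace_eq, ENNReal.ofReal_mul (heatProfile_nonneg _ _ _)]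

theorem toReal_trace_heatOperator (hq : 0 < q) {t : ℝ} (ht : 0 < t) :
    (τ.toFun (heatOperator q (diagonal p b) t)).toReal = ∑' n, heatProfile q t (b n) * d n := by
  rw [h.trace_heatOperator hq ht, ENNReal.toReal_ofReal]
  exact tsum_nonneg fun n => mul_nonneg (heatProfile_nonneg _ _ _) (h.trace_nonneg n)

theorem heatKernel_div_self_eq (hq : 0 < q) {t : ℝ} (ht : 0 < t) :
    heatKernel τ q (diagonal p b) t / t = (∑' n, heatProfile q t (b n) * d n) / t ^ 2 := by
  rw [heatKernel, h.toReal_trace_heatOperator hq ht]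
  field_simp

theorem heatKernel_div_self_nonneg (hq : 0 < q) {t : ℝ} (ht : 0 < t) :
    0 ≤ heatKernel τ q (diagonal p b) t / t := by
  rw [h.heatKernel_div_self_eq hq ht]
  exact div_nonneg (tsum_nonneg fun n => mul_nonneg (heatProfile_nonneg _ _ _) (h.trace_nonneg n))
    (sq_nonneg t)

theorem aemeasurable_heatKernel (hq : 0 < q) :
    AEMeasurable (heatKernel τ q (diagonal p b)) halfLine := by
  have hmono : MonotoneOn (fun t => (τ.toFun (heatOperator q (diagonal p b) t)).toReal)
      (Set.Ioi 0) := by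
    intro s hs t ht hst
    simp only [h.toReal_trace_heatOperator hq hs, h.toReal_trace_heatOperator hq ht]
    refine (h.summable_heatProfile_mul_trace hq hs).tsum_le_tsum (fun n => ?_)
      (h.summable_heatProfile_mul_trace hq ht)
    exact mul_le_mul_of_nonneg_right (heatProfile_mono hq hs hst _) (h.trace_nonneg n)
  have hinv : Measurable fun t : ℝ => 1 / t := by fun_prop
  exact hinv.aemeasurable.mul (aemeasurable_restrict_of_monotoneOn measurableSet_Ioi hmono)

theorem exists_heatKernel_div_self_le (hq : 0 < q) :
    ∃ C : ℝ, 0 < C ∧ ∀ (m : ℕ) (s : ℝ), 0 < s → heatKernel τ q (diagonal p b) s / s ≤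
      C * (∑ k ∈ Finset.range m, d k * b k * (b k / (1 + (b k * s) ^ 2)) +
        ∑' k, d (k + m) * b (k + m) ^ 2) := by
  obtain ⟨C, hC, hle⟩ := exists_heatProfile_le hq
  refine ⟨C, hC, fun m s hs => ?_⟩
  have hterm : ∀ k, heatProfile q s (b k) * d k / s ^ 2 ≤
      C * (d k * b k * (b k / (1 + (b k * s) ^ 2))) := fun k =>
    calc heatProfile q s (b k) * d k / s ^ 2
        ≤ C * ((s * b k) ^ 2 / (1 + (s * b k) ^ 2)) * d k / s ^ 2 := by
          have hd := h.trace_nonneg k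
          gcongr
          exact hle s (b k) hs
      _ = C * (d k * b k * (b k / (1 + (b k * s) ^ 2))) := by
          rw [mul_comm s]
          field_simp
  have hterm' : ∀ k, heatProfile q s (b k) * d k / s ^ 2 ≤ C * (d k * b k ^ 2) := fun k => by
    refine (hterm k).trans ?_
    have hb := h.eigenvalue_nonneg k
    have hd := h.trace_nonneg k
    have hdiv : b k / (1 + (b k * s) ^ 2) ≤ b k :=
      div_le_self hb (by nlinarith [sq_nonneg (b k * s)])
    rw [pow_two (b k), ← mul_assoc (d k)]
    gcongr
  have hsum := (h.summable_heatProfile_mul_trace hq hs).div_const (s ^ 2)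
  rw [h.heatKernel_div_self_eq hq hs, ← tsum_div_const, ← hsum.sum_add_tsum_nat_add m, mul_add,
    Finset.mul_sum, ← tsum_mul_left]
  refine add_le_add (Finset.sum_le_sum fun k _ => hterm k) ?_
  exact ((summable_nat_add_iff m).mpr hsum).tsum_le_tsum (fun k => hterm' (k + m))
    (((summable_nat_add_iff m).mpr h.summable_trace_mul_sq).mul_left C)

theorem exists_abs_heatKernel_div_self_le (hq : 0 < q) :
    ∃ V : ℝ, ∀ s, 0 < s → |heatKernel τ q (diagonal p b) s / s| ≤ V := by
  obtain ⟨C, -, hle⟩ := h.exists_heatKernel_div_self_le hq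
  refine ⟨C * ∑' k, d k * b k ^ 2, fun s hs => ?_⟩
  rw [abs_of_nonneg (h.heatKernel_div_self_nonneg hq hs)]
  simpa only [Finset.range_zero, Finset.sum_empty, zero_add, add_zero] using hle 0 s hs

theorem locallyIntegrableOn_heatKernel (hq : 0 < q) :
    LocallyIntegrableOn (heatKernel τ q (diagonal p b)) (Set.Ioi 0) := by
  obtain ⟨V, hV⟩ := h.exists_abs_heatKernel_div_self_le hq
  exact locallyIntegrableOn_of_abs_div_self_le (h.aemeasurable_heatKernel hq) hV

theorem exists_integral_heatKernel_div_self_le (hq : 0 < q) :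
    ∃ C : ℝ, 0 < C ∧ ∀ (m : ℕ) (T : ℝ), 1 ≤ T →
      ∫ s in (1 : ℝ)..T, heatKernel τ q (diagonal p b) s / s ≤
        C * (2 * ∑ k ∈ Finset.range m, d k * b k + T * ∑' k, d (k + m) * b (k + m) ^ 2) := by
  obtain ⟨C, hC, hle⟩ := h.exists_heatKernel_div_self_le hq
  obtain ⟨V, hV⟩ := h.exists_abs_heatKernel_div_self_le hq
  refine ⟨C, hC, fun m T hT => ?_⟩
  set tail := ∑' k, d (k + m) * b (k + m) ^ 2
  have htail : 0 ≤ tail :=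
    tsum_nonneg fun k => mul_nonneg (h.trace_nonneg _) (sq_nonneg _)
  have hcont : ∀ k, Continuous fun s : ℝ => d k * b k * (b k / (1 + (b k * s) ^ 2)) := fun k =>
    continuous_const.mul (Continuous.div (by fun_prop) (by fun_prop) fun s => by positivity)
  have hsum : Continuous fun s : ℝ =>
      ∑ k ∈ Finset.range m, d k * b k * (b k / (1 + (b k * s) ^ 2)) :=
    continuous_finsetSum _ fun k _ => hcont k
  calc ∫ s in (1 : ℝ)..T, heatKernel τ q (diagonal p b) s / s
      ≤ ∫ s in (1 : ℝ)..T,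
          C * (∑ k ∈ Finset.range m, d k * b k * (b k / (1 + (b k * s) ^ 2)) + tail) :=
        intervalIntegral.integral_mono_on hT
          (intervalIntegrable_div_self (h.aemeasurable_heatKernel hq) hV one_pos (by linarith))
          ((continuous_const.mul (hsum.add continuous_const)).intervalIntegrable 1 T)
          fun s hs => hle m s (by linarith [hs.1])
    _ = C * (∑ k ∈ Finset.range m,
          d k * b k * (∫ s in (1 : ℝ)..T, b k / (1 + (b k * s) ^ 2)) + (T - 1) * tail) := by
        rw [intervalIntegral.integral_const_mul, intervalIntegral.integral_add
          (hsum.intervalIntegrable 1 T) intervalIntegrable_const,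
          intervalIntegral.integral_finsetSum fun k _ => (hcont k).intervalIntegrable 1 T,
          intervalIntegral.integral_const, smul_eq_mul]
        simp only [intervalIntegral.integral_const_mul]
    _ ≤ C * (2 * ∑ k ∈ Finset.range m, d k * b k + T * tail) := by
        rw [mul_comm 2, Finset.sum_mul]
        gcongr with k
        · exact mul_nonneg (h.trace_nonneg k) (h.eigenvalue_nonneg k)
        · exact integral_div_one_add_sq_le (b k) (h.eigenvalue_nonneg k)
        · linarith

theorem exp_mul_le_heatKernel_div_self (hq : 0 < q) {n : ℕ} (hb : 0 < b n) {s : ℝ}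
    (hs : s ∈ Set.Icc (b n)⁻¹ (2 * (b n)⁻¹)) :
    Real.exp (-1) / 4 * (d n * b n ^ 2) ≤ heatKernel τ q (diagonal p b) s / s := by
  have hs0 : 0 < s := (inv_pos.mpr hb).trans_le hs.1
  have hlow : 1 ≤ s * b n := (inv_le_iff_one_le_mul₀ hb).mp hs.1
  have hupp : s * b n ≤ 2 := by
    calc s * b n ≤ 2 * (b n)⁻¹ * b n := by gcongr; exact hs.2
      _ = 2 := by field_simp
  have hd := h.trace_nonneg n
  rw [h.heatKernel_div_self_eq hq hs0, le_div_iff₀ (by positivity)]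
  calc Real.exp (-1) / 4 * (d n * b n ^ 2) * s ^ 2
      = Real.exp (-1) * d n * ((s * b n) ^ 2 / 2 ^ 2) := by ring
    _ ≤ Real.exp (-1) * d n * 1 := by
        gcongr
        exact div_le_one_of_le₀ (by gcongr) (by positivity)
    _ ≤ heatProfile q s (b n) * d n := by
        rw [mul_one]
        gcongr
        exact exp_neg_one_le_heatProfile hq hb hlow
    _ ≤ ∑' k, heatProfile q s (b k) * d k :=
        (h.summable_heatProfile_mul_trace hq hs0).le_tsum n fun k _ =>
          mul_nonneg (heatProfile_nonneg _ _ _) (h.trace_nonneg k)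

theorem exp_mul_div_log_le_cesaro_heatKernel (hq : 0 < q) {n : ℕ} (hb : 0 < b n) (hb1 : b n ≤ 1)
    {T : ℝ} (hT : 2 / b n ≤ T) :
    Real.exp (-1) / 4 * (d n * b n) / Real.log T ≤ cesaro (heatKernel τ q (diagonal p b)) T := by
  obtain ⟨V, hV⟩ := h.exists_abs_heatKernel_div_self_le hq
  have hcesaro := mul_div_log_le_cesaro (h.aemeasurable_heatKernel hq) hV
    (fun s => h.heatKernel_div_self_nonneg hq) ((one_le_inv₀ hb).mpr hb1)
    (fun s => h.exp_mul_le_heatKernel_div_self hq hb) hT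
  calc Real.exp (-1) / 4 * (d n * b n) / Real.log T
      = (b n)⁻¹ * (Real.exp (-1) / 4 * (d n * b n ^ 2)) / Real.log T := by field_simp
    _ ≤ _ := hcesaro

end IsSpectralData

section GeneralisedLimit

theorem quasiMeasurePreserving_exp :
    Measure.QuasiMeasurePreserving Real.exp volume halfLine := by
  refine ⟨Real.measurable_exp, Measure.AbsolutelyContinuous.mk fun A hA h0 => ?_⟩
  rw [halfLine, Measure.restrict_apply hA] at h0
  have himage : Real.exp ⁻¹' A = Real.log '' (A ∩ Set.Ioi 0) := by
    ext x
    constructor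
    · exact fun hx => ⟨Real.exp x, ⟨hx, Real.exp_pos x⟩, Real.log_exp x⟩
    · rintro ⟨y, ⟨hy, hy0⟩, rfl⟩
      rwa [Set.mem_preimage, Real.exp_log hy0]
  rw [Measure.map_apply Real.measurable_exp hA, himage]
  exact addHaar_image_eq_zero_of_differentiableOn_of_addHaar_eq_zero volume
    (fun y hy => (Real.differentiableAt_log hy.2.ne').differentiableWithinAt) h0

/-- The average of `z` over the window `[exp α, exp β]` for the dilation invariant measure
`dt / t`. -/
noncomputable def logAverage (α β : ℝ) (z : ℝ → ℝ) : ℝ := (β - α)⁻¹ * ∫ x in α..β, z (Real.exp x)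

theorem logAverage_congr {z w : ℝ → ℝ} (h : z =ᵐ[halfLine] w) (α β : ℝ) :
    logAverage α β z = logAverage α β w := by
  rw [logAverage, logAverage]
  congr 1
  refine intervalIntegral.integral_congr_ae ?_
  filter_upwards [quasiMeasurePreserving_exp.ae h] with x hx _ using hx

theorem logAverage_smul (c : ℝ) (z : ℝ → ℝ) (α β : ℝ) :
    logAverage α β (c • z) = c * logAverage α β z := by
  simp only [logAverage, Pi.smul_apply, smul_eq_mul, intervalIntegral.integral_const_mul]
  ring

theorem logAverage_const (c : ℝ) {α β : ℝ} (h : α < β) : logAverage α β (fun _ => c) = c := by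
  rw [logAverage, intervalIntegral.integral_const, smul_eq_mul,
    inv_mul_cancel_left₀ (sub_pos.mpr h).ne']

theorem logAverage_dilate (α β : ℝ) (z : ℝ → ℝ) {s : ℝ} (hs : 0 < s) :
    logAverage α β (fun t => z (t / s)) = logAverage (α - Real.log s) (β - Real.log s) z := by
  rw [logAverage, logAverage,
    ← intervalIntegral.integral_comp_sub_right (fun x => z (Real.exp x)) (Real.log s)]
  simp only [Real.exp_sub, Real.exp_log hs, sub_sub_sub_cancel_right]

section Bounded

variable {z : ℝ → ℝ} (hz : MemLp z ∞ halfLine)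
include hz

theorem ae_norm_comp_exp_le :
    ∀ᵐ x : ℝ, ‖z (Real.exp x)‖ ≤ (eLpNorm z ∞ halfLine).toReal := by
  have hfin := hz.2
  filter_upwards [quasiMeasurePreserving_exp.ae
    (ae_le_eLpNormEssSup (f := z) (μ := halfLine))] with x hx
  rw [eLpNorm_exponent_top] at hfin ⊢
  simpa using ENNReal.toReal_mono hfin.ne hx

theorem intervalIntegrable_comp_exp (α β : ℝ) :
    IntervalIntegrable (fun x => z (Real.exp x)) volume α β :=
  intervalIntegrable_iff.mpr <| Measure.integrableOn_of_bounded (by simp)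
    (hz.1.comp_quasiMeasurePreserving quasiMeasurePreserving_exp)
    (ae_restrict_of_ae (ae_norm_comp_exp_le hz))

theorem norm_integral_comp_exp_le (α β : ℝ) :
    ‖∫ x in α..β, z (Real.exp x)‖ ≤ (eLpNorm z ∞ halfLine).toReal * |β - α| :=
  intervalIntegral.norm_integral_le_of_norm_le_const_ae <| by
    filter_upwards [ae_norm_comp_exp_le hz] with x hx _ using hx

theorem logAverage_add {w : ℝ → ℝ} (hw : MemLp w ∞ halfLine) (α β : ℝ) :
    logAverage α β (z + w) = logAverage α β z + logAverage α β w := by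
  rw [logAverage, logAverage, logAverage, ← mul_add, ← intervalIntegral.integral_add
    (intervalIntegrable_comp_exp hz α β) (intervalIntegrable_comp_exp hw α β)]
  rfl

theorem le_logAverage {α β c : ℝ} (h : α < β)
    (hc : ∀ᵐ x, x ∈ Set.Icc α β → c ≤ z (Real.exp x)) : c ≤ logAverage α β z := by
  have hconst : ∫ _ in α..β, c = (β - α) * c := by simp
  rw [logAverage, le_inv_mul_iff₀ (sub_pos.mpr h), ← hconst]
  refine intervalIntegral.integral_mono_ae_restrict h.le (by simp)
    (intervalIntegrable_comp_exp hz α β) ?_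
  rwa [EventuallyLE, ae_restrict_iff' measurableSet_Icc]

theorem abs_logAverage_le {α β : ℝ} (h : α < β) :
    |logAverage α β z| ≤ (eLpNorm z ∞ halfLine).toReal := by
  have hpos : 0 < β - α := sub_pos.mpr h
  rw [logAverage, abs_mul, abs_of_pos (inv_pos.mpr hpos), inv_mul_le_iff₀ hpos, mul_comm]
  simpa only [Real.norm_eq_abs, abs_of_pos hpos] using norm_integral_comp_exp_le hz α β

theorem abs_logAverage_dilate_sub_le {s : ℝ} (hs : 0 < s) {α β : ℝ} (h : α < β) :
    |logAverage α β (fun t => z (t / s)) - logAverage α β z| ≤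
      (β - α)⁻¹ * (2 * (eLpNorm z ∞ halfLine).toReal * |Real.log s|) := by
  have hI := intervalIntegrable_comp_exp hz
  have hdiff := intervalIntegral.integral_interval_sub_interval_comm
    (hI (α - Real.log s) (β - Real.log s)) (hI α β) (hI (α - Real.log s) α)
  have hleft := norm_integral_comp_exp_le hz (α - Real.log s) α
  have hright := norm_integral_comp_exp_le hz (β - Real.log s) β
  rw [sub_sub_cancel, Real.norm_eq_abs] at hleft hright
  rw [logAverage_dilate α β z hs, logAverage, logAverage, sub_sub_sub_cancel_right, ← mul_sub,
    hdiff, abs_mul, abs_of_pos (inv_pos.mpr (sub_pos.mpr h))]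
  gcongr
  refine (abs_sub _ _).trans ?_
  linarith

end Bounded

/-- The functional `ω` is the limit along `l` of the logarithmic averages over the windows
`[exp (α i), exp (β i)]`. -/
def IsLogAverageLimit {ι : Type*} (l : Filter ι) (α β : ι → ℝ) (ω : LInfty →ₗ[ℝ] ℝ) : Prop :=
  ∀ (z : ℝ → ℝ) (hz : MemLp z ∞ halfLine),
    Tendsto (fun i => logAverage (α i) (β i) z) l (𝓝 (ω (hz.toLp z)))

theorem exists_isLogAverageLimit {ι : Type*} (U : Ultrafilter ι) {α β : ι → ℝ}
    (hlt : ∀ᶠ i in U, α i < β i) : ∃ ω, IsLogAverageLimit U α β ω := by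
  have hex : ∀ z : LInfty, ∃ l, Tendsto (fun i => logAverage (α i) (β i) z) U (𝓝 l) := by
    intro z
    have hmem : ∀ᶠ i in U, logAverage (α i) (β i) z ∈
        Set.Icc (-(eLpNorm z ∞ halfLine).toReal) (eLpNorm z ∞ halfLine).toReal :=
      hlt.mono fun i hi => abs_le.mp (abs_logAverage_le (Lp.memLp z) hi)
    obtain ⟨l, -, hl⟩ := isCompact_Icc.ultrafilter_le_nhds
      (U.map fun i => logAverage (α i) (β i) z) (le_principal_iff.mpr hmem)
    exact ⟨l, hl⟩
  choose lim hlim using hex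
  let ω : LInfty →ₗ[ℝ] ℝ :=
    { toFun := lim
      map_add' := fun z w => by
        refine tendsto_nhds_unique (hlim (z + w)) (((hlim z).add (hlim w)).congr fun i => ?_)
        rw [← logAverage_add (Lp.memLp z) (Lp.memLp w)]
        exact logAverage_congr (Lp.coeFn_add z w).symm _ _
      map_smul' := fun c z => by
        refine tendsto_nhds_unique (hlim (c • z)) (((hlim z).const_mul c).congr fun i => ?_)
        rw [← logAverage_smul]
        exact logAverage_congr (Lp.coeFn_smul c z).symm _ _ }
  exact ⟨ω, fun z hz => (hlim (hz.toLp z)).congr fun i => logAverage_congr hz.coeFn_toLp _ _⟩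

namespace IsLogAverageLimit

variable {ι : Type*} {l : Filter ι} [l.NeBot] {α β : ι → ℝ} {ω : LInfty →ₗ[ℝ] ℝ}

theorem le_apply (h : IsLogAverageLimit l α β ω) (hlt : ∀ᶠ i in l, α i < β i) {z : ℝ → ℝ}
    (hz : MemLp z ∞ halfLine) {c : ℝ}
    (hc : ∀ᶠ i in l, ∀ᵐ x, x ∈ Set.Icc (α i) (β i) → c ≤ z (Real.exp x)) :
    c ≤ ω (hz.toLp z) := by
  refine ge_of_tendsto (h z hz) ?_
  filter_upwards [hlt, hc] with i hi hci using le_logAverage hz hi hci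

theorem apply_eq_zero (h : IsLogAverageLimit l α β ω) (hlt : ∀ᶠ i in l, α i < β i) {z : ℝ → ℝ}
    (hz : MemLp z ∞ halfLine)
    (h0 : ∀ ε > 0, ∀ᶠ i in l, ∀ x ∈ Set.Icc (α i) (β i), |z (Real.exp x)| ≤ ε) :
    ω (hz.toLp z) = 0 := by
  have hlower : ∀ ε > 0, -ε ≤ ω (hz.toLp z) := fun ε hε => h.le_apply hlt hz <|
    (h0 ε hε).mono fun i hi => Eventually.of_forall fun x hx => (abs_le.mp (hi x hx)).1
  have hupper : ∀ ε > 0, -ε ≤ -ω (hz.toLp z) := fun ε hε => by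
    rw [← map_neg, ← MemLp.toLp_neg hz]
    exact h.le_apply hlt hz.neg <| (h0 ε hε).mono fun i hi =>
      Eventually.of_forall fun x hx => neg_le_neg (abs_le.mp (hi x hx)).2
  refine le_antisymm (le_of_forall_pos_le_add fun ε hε => ?_)
    (le_of_forall_pos_le_add fun ε hε => ?_)
  · linarith [hupper ε hε]
  · linarith [hlower ε hε]

theorem isGeneralisedLimit (h : IsLogAverageLimit l α β ω) (hα : Tendsto α l atTop)
    (hlt : ∀ᶠ i in l, α i < β i) : IsGeneralisedLimit ω where
  nonneg z hz := by
    rw [← Lp.toLp_coeFn z (Lp.memLp z)]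
    refine h.le_apply hlt (Lp.memLp z) (Eventually.of_forall fun i => ?_)
    filter_upwards [quasiMeasurePreserving_exp.ae ((Lp.coeFn_nonneg z).mpr hz)] with x hx _ using hx
  normalised := tendsto_nhds_unique (h _ _) <| tendsto_const_nhds.congr' <|
    hlt.mono fun _ hi => (logAverage_const 1 hi).symm
  vanishes z hz hz0 := by
    refine h.apply_eq_zero hlt hz fun ε hε => ?_
    obtain ⟨R, hR⟩ := eventually_atTop.mp
      (hz0.eventually (Metric.closedBall_mem_nhds (0 : ℝ) hε))
    filter_upwards [(Real.tendsto_exp_atTop.comp hα).eventually_ge_atTop R] with i hi x hx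
    simpa using hR _ (hi.trans (Real.exp_le_exp.mpr hx.1))

theorem isDilationInvariant (h : IsLogAverageLimit l α β ω)
    (hαβ : Tendsto (fun i => β i - α i) l atTop) : IsDilationInvariant ω := by
  intro z hz s hs
  have hbound : Tendsto (fun i => (β i - α i)⁻¹ *
      (2 * (eLpNorm z ∞ halfLine).toReal * |Real.log s|)) l (𝓝 0) := by
    simpa using hαβ.inv_tendsto_atTop.mul_const _
  rw [← sub_eq_zero]
  refine tendsto_nhds_unique ((h _ (memLp_dilate hz hs)).sub (h z hz))
    (squeeze_zero_norm' ?_ hbound)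
  filter_upwards [hαβ.eventually_gt_atTop 0] with i hi
  exact abs_logAverage_dilate_sub_le hz hs (sub_pos.mp hi)

end IsLogAverageLimit

end GeneralisedLimit

section RapidGrowth

theorem summable_of_succ_le_half {c : ℕ → ℝ} (h0 : ∀ n, 0 ≤ c n) (h : ∀ n, c (n + 1) ≤ c n / 2) :
    Summable c := by
  refine summable_of_ratio_norm_eventually_le (r := 1 / 2) (by norm_num)
    (Eventually.of_forall fun n => ?_)
  rw [Real.norm_of_nonneg (h0 _), Real.norm_of_nonneg (h0 _)]
  linarith [h n]

theorem tsum_add_le_of_succ_le_half {c : ℕ → ℝ} (h0 : ∀ n, 0 ≤ c n)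
    (h : ∀ n, c (n + 1) ≤ c n / 2) (m : ℕ) : ∑' k, c (k + m) ≤ 2 * c m := by
  have hle : ∀ k, c (k + m) ≤ c m * (1 / 2) ^ k := by
    intro k
    induction k with
    | zero => simp
    | succ k ih =>
      rw [Nat.add_right_comm, pow_succ]
      linarith [h (k + m)]
  calc ∑' k, c (k + m) ≤ ∑' k, c m * (1 / 2) ^ k :=
        ((summable_nat_add_iff m).mpr (summable_of_succ_le_half h0 h)).tsum_le_tsum hle
          (summable_geometric_two.mul_left _)
    _ = 2 * c m := by rw [tsum_mul_left, tsum_geometric_two, mul_comm]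

/-- At least iterated squaring growth, for the logarithms `L n` of the traces of the spectral
projections of the counterexample: each term then dominates the sum of all previous ones. -/
structure IsRapid (L : ℕ → ℝ) : Prop where
  le : ∀ n, 100 ≤ L n
  sq_le : ∀ n, (2 * L n) ^ 2 ≤ L (n + 1)

/-- The eigenvalue `L n * exp (-L n)` of the counterexample on a spectral projection of trace
`exp (L n)`; this projection contributes `L n` to the trace of the operator. -/
noncomputable def rapidEigenvalue (L : ℕ → ℝ) (n : ℕ) : ℝ := L n * Real.exp (-L n)

theorem exp_mul_rapidEigenvalue (L : ℕ → ℝ) (n : ℕ) :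
    Real.exp (L n) * rapidEigenvalue L n = L n := by
  rw [rapidEigenvalue, mul_left_comm, ← Real.exp_add, add_neg_cancel, Real.exp_zero, mul_one]

theorem exp_mul_rapidEigenvalue_sq (L : ℕ → ℝ) (n : ℕ) :
    Real.exp (L n) * rapidEigenvalue L n ^ 2 = L n * rapidEigenvalue L n := by
  rw [pow_two, ← mul_assoc, exp_mul_rapidEigenvalue]

theorem rapidEigenvalue_le_exp (L : ℕ → ℝ) (n : ℕ) :
    rapidEigenvalue L n ≤ 2 * Real.exp (-(L n / 2)) :=
  calc L n * Real.exp (-L n) ≤ 2 * Real.exp (L n / 2) * Real.exp (-L n) := by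
        gcongr
        linarith [Real.add_one_le_exp (L n / 2)]
    _ = 2 * Real.exp (-(L n / 2)) := by
        rw [mul_assoc, ← Real.exp_add]
        ring_nf

theorem rapidEigenvalue_le_one (L : ℕ → ℝ) (n : ℕ) : rapidEigenvalue L n ≤ 1 := by
  rw [rapidEigenvalue, Real.exp_neg, ← div_eq_mul_inv, div_le_one (Real.exp_pos _)]
  linarith [Real.add_one_le_exp (L n)]

namespace IsRapid

variable {L : ℕ → ℝ} (h : IsRapid L)
include h

theorem pos (n : ℕ) : 0 < L n := by linarith [h.le n]

theorem add_one_le (n : ℕ) : L n + 1 ≤ L (n + 1) := by nlinarith [h.le n, h.sq_le n]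

theorem tendsto_atTop : Tendsto L atTop atTop := by
  refine tendsto_atTop_mono (fun n => ?_) tendsto_natCast_atTop_atTop
  induction n with
  | zero => exact_mod_cast (h.pos 0).le
  | succ n ih =>
    push_cast
    linarith [h.add_one_le n]

theorem sqrt_le (n : ℕ) : √(L n) ≤ L n :=
  Real.sqrt_le_self_iff.mpr (.inr (by linarith [h.le n]))

theorem sum_range_le_sqrt (n : ℕ) : ∑ k ∈ Finset.range n, L k ≤ √(L n) := by
  induction n with
  | zero => simp
  | succ n ih =>
    rw [Finset.sum_range_succ]
    have hnonneg : 0 ≤ ∑ k ∈ Finset.range n, L k := Finset.sum_nonneg fun k _ => (h.pos k).le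
    exact Real.le_sqrt_of_sq_le
      ((pow_le_pow_left₀ (by linarith [h.pos n]) (by linarith [h.sqrt_le n]) 2).trans (h.sq_le n))

theorem sum_range_succ_exp_le (n : ℕ) :
    ∑ k ∈ Finset.range (n + 1), Real.exp (L k) ≤ 2 * Real.exp (L n) := by
  induction n with
  | zero => simpa using by linarith [Real.exp_pos (L 0)]
  | succ n ih =>
    have hdouble : 2 * Real.exp (L n) ≤ Real.exp (L (n + 1)) := by
      calc 2 * Real.exp (L n) ≤ Real.exp 1 * Real.exp (L n) := by
            gcongr
            linarith [Real.add_one_le_exp 1]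
        _ = Real.exp (L n + 1) := by rw [← Real.exp_add, add_comm]
        _ ≤ Real.exp (L (n + 1)) := Real.exp_le_exp.mpr (h.add_one_le n)
    rw [Finset.sum_range_succ]
    linarith

theorem rapidEigenvalue_pos (n : ℕ) : 0 < rapidEigenvalue L n :=
  mul_pos (h.pos n) (Real.exp_pos _)

theorem mul_rapidEigenvalue_succ_le (n : ℕ) :
    L (n + 1) * rapidEigenvalue L (n + 1) ≤ L n * rapidEigenvalue L n / 2 := by
  have hx := h.le n
  have hy := h.sq_le n
  have hy100 := h.le (n + 1)
  simp only [rapidEigenvalue]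
  set x := L n
  set y := L (n + 1)
  have hcube : (y / 2) ^ 3 / 6 ≤ Real.exp (y / 2) := by
    simpa [Nat.factorial] using Real.pow_div_factorial_le_exp (y / 2) (by linarith) 3
  have hpoly : 2 * y ^ 2 ≤ Real.exp (y - x) :=
    calc 2 * y ^ 2 ≤ (y / 2) ^ 3 / 6 := by nlinarith [sq_nonneg y]
      _ ≤ Real.exp (y / 2) := hcube
      _ ≤ Real.exp (y - x) := Real.exp_le_exp.mpr (by nlinarith)
  calc y * (y * Real.exp (-y)) = 2 * y ^ 2 * Real.exp (-y) / 2 := by ring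
    _ ≤ Real.exp (y - x) * Real.exp (-y) / 2 := by gcongr
    _ = 1 * Real.exp (-x) / 2 := by rw [← Real.exp_add]; ring_nf
    _ ≤ x ^ 2 * Real.exp (-x) / 2 := by gcongr; nlinarith
    _ = x * (x * Real.exp (-x)) / 2 := by ring

theorem rapidEigenvalue_succ_le (n : ℕ) :
    rapidEigenvalue L (n + 1) ≤ rapidEigenvalue L n / 2 := by
  refine le_of_mul_le_mul_left ?_ (h.pos n)
  calc L n * rapidEigenvalue L (n + 1) ≤ L (n + 1) * rapidEigenvalue L (n + 1) := by
        gcongr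
        · exact (h.rapidEigenvalue_pos _).le
        · linarith [h.add_one_le n]
    _ ≤ L n * rapidEigenvalue L n / 2 := h.mul_rapidEigenvalue_succ_le n
    _ = L n * (rapidEigenvalue L n / 2) := by ring

theorem mul_rapidEigenvalue_le_exp (n : ℕ) :
    L n * rapidEigenvalue L n ≤ 8 * Real.exp (-(L n / 2)) := by
  have hsq : (L n / 2) ^ 2 / 2 ≤ Real.exp (L n / 2) := by
    simpa [Nat.factorial] using
      Real.pow_div_factorial_le_exp (L n / 2) (by linarith [h.pos n]) 2
  calc L n * (L n * Real.exp (-L n)) = 8 * ((L n / 2) ^ 2 / 2) * Real.exp (-L n) := by ring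
    _ ≤ 8 * Real.exp (L n / 2) * Real.exp (-L n) := by gcongr
    _ = 8 * Real.exp (-(L n / 2)) := by
        rw [mul_assoc, ← Real.exp_add]
        ring_nf

theorem exists_sum_range_add_mul_le_log {T : ℝ} (hT : 0 < T) :
    ∃ m, ∑ k ∈ Finset.range m, L k + T * (L m * rapidEigenvalue L m) ≤ 12 * Real.log (1 + T) := by
  have hlog : 0 < Real.log (1 + T) := Real.log_pos (by linarith)
  have hex : ∃ m, 2 * Real.log (1 + T) < L m := (h.tendsto_atTop.eventually_gt_atTop _).exists
  obtain ⟨m, hm, hmin⟩ : ∃ m, 2 * Real.log (1 + T) < L m ∧ ∀ k < m, L k ≤ 2 * Real.log (1 + T) :=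
    ⟨Nat.find hex, Nat.find_spec hex, fun k hk => not_lt.mp (Nat.find_min hex hk)⟩
  have hhead : ∑ k ∈ Finset.range m, L k ≤ 4 * Real.log (1 + T) := by
    cases m with
    | zero => simpa using hlog.le
    | succ k =>
      rw [Finset.sum_range_succ]
      linarith [h.sum_range_le_sqrt k, h.sqrt_le k, hmin k k.lt_succ_self]
  have htail : T * (L m * rapidEigenvalue L m) ≤ 8 * Real.log (1 + T) :=
    calc T * (L m * rapidEigenvalue L m) ≤ T * (8 * Real.exp (-(L m / 2))) :=
          mul_le_mul_of_nonneg_left (h.mul_rapidEigenvalue_le_exp m) hT.le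
      _ ≤ T * (8 * Real.exp (-Real.log (1 + T))) := by gcongr; linarith
      _ = 8 * (1 - (1 + T)⁻¹) := by
          rw [Real.exp_neg, Real.exp_log (by linarith)]
          field_simp
          ring
      _ ≤ 8 * Real.log (1 + T) := by
          gcongr
          exact Real.one_sub_inv_le_log_of_pos (by linarith)
  exact ⟨m, by linarith⟩

end IsRapid

theorem FNSTrace.exists_isRapid (τ : FNSTrace N) (hτ : τ.toFun 1 = ∞) :
    ∃ (p : ℕ → H →L[ℂ] H) (L : ℕ → ℝ), IsOrthogonalProjections p ∧ (∀ n, p n ∈ N) ∧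
      (∀ n, τ.toFun (p n) = ENNReal.ofReal (Real.exp (L n))) ∧ IsRapid L := by
  have hmono : MonotoneOn (fun x => Real.exp ((2 * Real.log (1 + x)) ^ 2 + 100)) (Set.Ici 0) := by
    intro x (hx : 0 ≤ x) y _ hxy
    have : 0 ≤ Real.log (1 + x) := Real.log_nonneg (by linarith)
    dsimp only
    gcongr
  obtain ⟨p, hp, hmem, hfin, h0, hsucc⟩ := τ.exists_orthogonalProjections_trace_ge hτ hmono
  have hge : ∀ n, Real.exp 100 ≤ (τ.toFun (p n)).toReal := by
    rintro (_ | n)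
    · simpa using h0
    · exact (Real.exp_le_exp.mpr (le_add_of_nonneg_left (sq_nonneg _))).trans (hsucc n)
  have hpos : ∀ n, 0 < (τ.toFun (p n)).toReal := fun n => (Real.exp_pos _).trans_le (hge n)
  have hlog : ∀ n, 100 ≤ Real.log (τ.toFun (p n)).toReal := fun n =>
    (Real.le_log_iff_exp_le (hpos n)).mpr (hge n)
  refine ⟨p, fun n => Real.log (τ.toFun (p n)).toReal, hp, hmem, fun n => ?_, hlog, fun n => ?_⟩
  · rw [Real.exp_log (hpos n), ENNReal.ofReal_toReal (hfin n)]
  · have hle := (Real.le_log_iff_exp_le (hpos (n + 1))).mpr (hsucc n)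
    have := hlog n
    have : Real.log (τ.toFun (p n)).toReal ≤ Real.log (1 + (τ.toFun (p n)).toReal) :=
      Real.log_le_log (hpos n) (by linarith)
    nlinarith

end RapidGrowth

section Counterexample

/-- The logarithm of the left end `2 / a n` of the `n`-th window, where `a` is `rapidEigenvalue`.
From there on the `n`-th eigenvalue makes its full contribution to the heat kernel integral. -/
noncomputable def windowStart (L : ℕ → ℝ) (n : ℕ) : ℝ := Real.log (2 / rapidEigenvalue L n)

/-- The logarithm of the right end `√(L n) / a n` of the `n`-th window, where `a` is
`rapidEigenvalue`. Up to there the `n`-th eigenvalue contributes only `√(L n)` to the integral of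
the singular value function. -/
noncomputable def windowEnd (L : ℕ → ℝ) (n : ℕ) : ℝ := Real.log (√(L n) / rapidEigenvalue L n)

namespace IsRapid

section Window

variable {L : ℕ → ℝ} (hL : IsRapid L)
include hL

theorem half_le_windowStart (n : ℕ) : L n / 2 ≤ windowStart L n := by
  rw [windowStart, Real.le_log_iff_exp_le (div_pos two_pos (hL.rapidEigenvalue_pos n)),
    le_div_iff₀ (hL.rapidEigenvalue_pos n)]
  calc Real.exp (L n / 2) * rapidEigenvalue L n
      ≤ Real.exp (L n / 2) * (2 * Real.exp (-(L n / 2))) := by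
        gcongr
        exact rapidEigenvalue_le_exp L n
    _ = 2 := by rw [mul_left_comm, ← Real.exp_add, add_neg_cancel, Real.exp_zero, mul_one]

theorem windowEnd_le (n : ℕ) : windowEnd L n ≤ L n := by
  have ha := hL.rapidEigenvalue_pos n
  rw [windowEnd, Real.log_le_iff_le_exp (div_pos (Real.sqrt_pos.mpr (hL.pos n)) ha),
    div_le_iff₀ ha, exp_mul_rapidEigenvalue]
  exact hL.sqrt_le n

theorem windowEnd_sub_windowStart (n : ℕ) :
    windowEnd L n - windowStart L n = Real.log √(L n) - Real.log 2 := by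
  have ha := (hL.rapidEigenvalue_pos n).ne'
  rw [windowEnd, windowStart, Real.log_div (Real.sqrt_pos.mpr (hL.pos n)).ne' ha,
    Real.log_div two_ne_zero ha, sub_sub_sub_cancel_right]

theorem tendsto_windowStart : Tendsto (windowStart L) atTop atTop :=
  tendsto_atTop_mono hL.half_le_windowStart (hL.tendsto_atTop.atTop_div_const two_pos)

theorem tendsto_windowEnd_sub_windowStart :
    Tendsto (fun n => windowEnd L n - windowStart L n) atTop atTop := by
  simp only [hL.windowEnd_sub_windowStart]
  exact tendsto_atTop_add_const_right _ _
    (Real.tendsto_log_atTop.comp (Real.tendsto_sqrt_atTop.comp hL.tendsto_atTop))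

theorem eventually_windowStart_lt_windowEnd :
    ∀ᶠ n in atTop, windowStart L n < windowEnd L n :=
  (hL.tendsto_windowEnd_sub_windowStart.eventually_gt_atTop 0).mono fun _ => sub_pos.mp

theorem two_div_le_exp {n : ℕ} {x : ℝ} (hx : windowStart L n ≤ x) :
    2 / rapidEigenvalue L n ≤ Real.exp x :=
  (Real.log_le_iff_le_exp (div_pos two_pos (hL.rapidEigenvalue_pos n))).mp hx

theorem exp_mul_le_sqrt {n : ℕ} {x : ℝ} (hx : x ≤ windowEnd L n) :
    Real.exp x * rapidEigenvalue L n ≤ √(L n) := by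
  have ha := hL.rapidEigenvalue_pos n
  rw [← le_div_iff₀ ha]
  exact (Real.le_log_iff_exp_le (div_pos (Real.sqrt_pos.mpr (hL.pos n)) ha)).mp hx

theorem isSpectralData {τ : FNSTrace N} {p : ℕ → H →L[ℂ] H} (hp : IsOrthogonalProjections p)
    (hmem : ∀ n, p n ∈ N) (htrace : ∀ n, τ.toFun (p n) = ENNReal.ofReal (Real.exp (L n))) :
    IsSpectralData τ p (rapidEigenvalue L) fun n => Real.exp (L n) where
  toIsOrthogonalProjections := hp
  mem := hmem
  trace_eq := htrace
  eigenvalue_nonneg n := (hL.rapidEigenvalue_pos n).le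
  trace_nonneg n := (Real.exp_pos _).le
  summable_eigenvalue :=
    summable_of_succ_le_half (fun n => (hL.rapidEigenvalue_pos n).le) hL.rapidEigenvalue_succ_le
  summable_trace_mul_sq := by
    simp only [exp_mul_rapidEigenvalue_sq]
    exact summable_of_succ_le_half
      (fun n => mul_nonneg (hL.pos n).le (hL.rapidEigenvalue_pos n).le)
      hL.mul_rapidEigenvalue_succ_le

end Window

variable {τ : FNSTrace N} {p : ℕ → H →L[ℂ] H} {L : ℕ → ℝ} (hL : IsRapid L)
  (h : IsSpectralData τ p (rapidEigenvalue L) fun n => Real.exp (L n))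
include hL h

theorem integral_singularValue_le (m : ℕ) {t : ℝ} (ht : 0 ≤ t) :
    ∫ s in (0 : ℝ)..t, singularValue τ (diagonal p (rapidEigenvalue L)) s ≤
      2 * (∑ k ∈ Finset.range m, L k + t * rapidEigenvalue L m) := by
  have hterm : ∀ k, (∑ j ∈ Finset.range (k + 1), Real.exp (L j)) * rapidEigenvalue L k ≤
      2 * L k := fun k =>
    calc (∑ j ∈ Finset.range (k + 1), Real.exp (L j)) * rapidEigenvalue L k
        ≤ 2 * Real.exp (L k) * rapidEigenvalue L k :=
          mul_le_mul_of_nonneg_right (hL.sum_range_succ_exp_le k) (hL.rapidEigenvalue_pos k).le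
      _ = 2 * L k := by rw [mul_assoc, exp_mul_rapidEigenvalue]
  calc _ ≤ ∑ k ∈ Finset.range m,
          (∑ j ∈ Finset.range (k + 1), Real.exp (L j)) * rapidEigenvalue L k +
        t * ∑' k, rapidEigenvalue L (k + m) := h.integral_singularValue_le m ht
    _ ≤ ∑ k ∈ Finset.range m, 2 * L k + t * (2 * rapidEigenvalue L m) := by
        gcongr ∑ k ∈ _, ?_ + t * ?_
        · exact hterm _
        · exact tsum_add_le_of_succ_le_half (fun n => (hL.rapidEigenvalue_pos n).le)
            hL.rapidEigenvalue_succ_le m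
    _ = 2 * (∑ k ∈ Finset.range m, L k + t * rapidEigenvalue L m) := by
        rw [← Finset.mul_sum]
        ring

theorem dixmierMean_le {t : ℝ} (ht : 0 < t) :
    dixmierMean τ (diagonal p (rapidEigenvalue L)) t ≤ 24 := by
  obtain ⟨m, hm⟩ := hL.exists_sum_range_add_mul_le_log ht
  have hle : rapidEigenvalue L m ≤ L m * rapidEigenvalue L m :=
    le_mul_of_one_le_left (hL.rapidEigenvalue_pos m).le (by linarith [hL.le m])
  rw [dixmierMean, one_div_mul_eq_div, div_le_iff₀ (Real.log_pos (by linarith))]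
  linarith [hL.integral_singularValue_le h m ht.le, mul_le_mul_of_nonneg_left hle ht.le]

theorem diagonal_mem_dixmierIdeal : diagonal p (rapidEigenvalue L) ∈ dixmierIdeal τ := by
  refine ⟨h.diagonal_mem h.mem h.summable_eigenvalue, 24, ?_⟩
  rintro _ ⟨t, ht, rfl⟩
  exact hL.dixmierMean_le h ht

theorem memLp_cesaro_heatKernel {q : ℝ} (hq : 0 < q) :
    MemLp (cesaro (heatKernel τ q (diagonal p (rapidEigenvalue L)))) ∞ halfLine := by
  obtain ⟨V, hV⟩ := h.exists_abs_heatKernel_div_self_le hq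
  obtain ⟨C, hC, hint⟩ := h.exists_integral_heatKernel_div_self_le hq
  simp only [exp_mul_rapidEigenvalue, exp_mul_rapidEigenvalue_sq] at hint
  refine memLp_cesaro (C := 24 * C) (h.aemeasurable_heatKernel hq) hV fun T hT => ?_
  have hT0 : 0 < T := one_pos.trans_le hT
  obtain ⟨m, hm⟩ := hL.exists_sum_range_add_mul_le_log hT0
  have htail := tsum_add_le_of_succ_le_half
    (fun n => mul_nonneg (hL.pos n).le (hL.rapidEigenvalue_pos n).le)
    hL.mul_rapidEigenvalue_succ_le m
  rw [abs_of_nonneg (intervalIntegral.integral_nonneg hT fun s hs =>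
    h.heatKernel_div_self_nonneg hq (one_pos.trans_le hs.1))]
  calc _ ≤ C * (2 * ∑ k ∈ Finset.range m, L k + T * ∑' k, L (k + m) * rapidEigenvalue L (k + m)) :=
        hint m T hT
    _ ≤ C * (2 * ∑ k ∈ Finset.range m, L k + T * (2 * (L m * rapidEigenvalue L m))) := by gcongr
    _ = 2 * C * (∑ k ∈ Finset.range m, L k + T * (L m * rapidEigenvalue L m)) := by ring
    _ ≤ 2 * C * (12 * Real.log (1 + T)) := by gcongr
    _ = 24 * C * Real.log (1 + T) := by ring

theorem dixmierMean_exp_le_of_mem_window {n : ℕ} {x : ℝ}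
    (hx : x ∈ Set.Icc (windowStart L n) (windowEnd L n)) :
    dixmierMean τ (diagonal p (rapidEigenvalue L)) (Real.exp x) ≤ 8 / √(L n) := by
  have hlog : L n / 2 ≤ Real.log (1 + Real.exp x) :=
    calc L n / 2 ≤ x := (hL.half_le_windowStart n).trans hx.1
      _ = Real.log (Real.exp x) := (Real.log_exp x).symm
      _ ≤ Real.log (1 + Real.exp x) := Real.log_le_log (Real.exp_pos x) (by linarith)
  rw [dixmierMean, one_div_mul_eq_div]
  calc _ ≤ 4 * √(L n) / (L n / 2) := by
        gcongr
        · linarith [hL.pos n]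
        · linarith [hL.integral_singularValue_le h n (Real.exp_pos x).le,
            hL.sum_range_le_sqrt n, hL.exp_mul_le_sqrt hx.2]
    _ = 8 * (√(L n) / L n) := by ring
    _ = 8 / √(L n) := by rw [Real.sqrt_div_self, div_eq_mul_inv]

theorem le_cesaro_heatKernel_exp_of_mem_window {q : ℝ} (hq : 0 < q) {n : ℕ} {x : ℝ}
    (hx : x ∈ Set.Icc (windowStart L n) (windowEnd L n)) :
    Real.exp (-1) / 4 ≤
      cesaro (heatKernel τ q (diagonal p (rapidEigenvalue L))) (Real.exp x) := by
  have hxpos : 0 < x := by linarith [hL.half_le_windowStart n, hx.1, hL.pos n]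
  have hcesaro := h.exp_mul_div_log_le_cesaro_heatKernel hq (hL.rapidEigenvalue_pos n)
    (rapidEigenvalue_le_one L n) (hL.two_div_le_exp hx.1)
  rw [exp_mul_rapidEigenvalue, Real.log_exp] at hcesaro
  refine le_trans ?_ hcesaro
  rw [le_div_iff₀ hxpos]
  gcongr
  exact hx.2.trans (hL.windowEnd_le n)

section Limit

variable {l : Filter ℕ} [l.NeBot] {ω : LInfty →ₗ[ℝ] ℝ}
  (hl : l ≤ atTop)
  (hω : IsLogAverageLimit l (windowStart L) (windowEnd L) ω)
include hl hω

theorem dixmierTrace_eq_zero : dixmierTrace τ ω (diagonal p (rapidEigenvalue L)) = 0 := by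
  have hmean := memLp_dixmierMean τ _ fun t => hL.dixmierMean_le h
  have hsqrt : Tendsto (fun n => 8 / √(L n)) atTop (𝓝 0) :=
    (Real.tendsto_sqrt_atTop.comp hL.tendsto_atTop).const_div_atTop 8
  rw [dixmierTrace, evalAt, dif_pos hmean]
  refine hω.apply_eq_zero (hl hL.eventually_windowStart_lt_windowEnd) hmean fun ε hε => ?_
  filter_upwards [hl (hsqrt.eventually_le_const hε)] with n hn x hx
  rw [abs_of_nonneg (dixmierMean_nonneg τ _ (Real.exp_pos x))]
  exact (hL.dixmierMean_exp_le_of_mem_window h hx).trans hn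

theorem heatFunctional_pos {q : ℝ} (hq : 0 < q) :
    0 < heatFunctional τ q ω (diagonal p (rapidEigenvalue L)) := by
  rw [heatFunctional, evalAt, dif_pos (hL.memLp_cesaro_heatKernel h hq)]
  exact (div_pos (Real.exp_pos (-1)) four_pos).trans_le <|
    hω.le_apply (hl hL.eventually_windowStart_lt_windowEnd) _ <| Eventually.of_forall fun n =>
      Eventually.of_forall fun x => hL.le_cesaro_heatKernel_exp_of_mem_window h hq

end Limit

end IsRapid

end Counterexample

end NoncommHeat

theorem mainTheorem6_general {H : Type*} [NormedAddCommGroup H] [InnerProductSpace ℂ H]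
    [CompleteSpace H] (N : VonNeumannAlgebra H) (τ : FNSTrace N) (hτ : τ.toFun 1 = ∞) :
    ∃ (A : H →L[ℂ] H) (ω : LInfty →ₗ[ℝ] ℝ),
      A ∈ dixmierIdeal τ ∧ 0 ≤ A ∧ IsGeneralisedLimit ω ∧ IsDilationInvariant ω ∧
      MemLp (dixmierMean τ A) ∞ halfLine ∧ dixmierTrace τ ω A = 0 ∧
      ∀ q : ℝ, 0 < q →
        (∀ t : ℝ, 0 < t → τ.toFun (heatOperator q A t) ≠ ∞) ∧
        LocallyIntegrableOn (heatKernel τ q A) (Set.Ioi 0) ∧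
        MemLp (cesaro (heatKernel τ q A)) ∞ halfLine ∧ 0 < heatFunctional τ q ω A := by
  obtain ⟨p, L, hp, hmem, htrace, hL⟩ := τ.exists_isRapid hτ
  have h := hL.isSpectralData hp hmem htrace
  have hl : (hyperfilter ℕ : Filter ℕ) ≤ atTop := Nat.hyperfilter_le_atTop
  have hlt := hl hL.eventually_windowStart_lt_windowEnd
  obtain ⟨ω, hω⟩ := exists_isLogAverageLimit (hyperfilter ℕ) hlt
  refine ⟨diagonal p (rapidEigenvalue L), ω, hL.diagonal_mem_dixmierIdeal h,
    h.diagonal_nonneg h.eigenvalue_nonneg,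
    hω.isGeneralisedLimit (hL.tendsto_windowStart.mono_left hl) hlt,
    hω.isDilationInvariant (hL.tendsto_windowEnd_sub_windowStart.mono_left hl),
    memLp_dixmierMean τ _ fun t => hL.dixmierMean_le h, hL.dixmierTrace_eq_zero h hl hω,
    fun q hq => ⟨fun t ht => ?_, h.locallyIntegrableOn_heatKernel hq,
      hL.memLp_cesaro_heatKernel h hq, hL.heatFunctional_pos h hl hω hq⟩⟩
  rw [h.trace_heatOperator hq ht]
  exact ENNReal.ofReal_ne_top

theorem mainTheorem6 {H : Type*} [NormedAddCommGroup H] [InnerProductSpace ℂ H] [CompleteSpace H]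
    (N : VonNeumannAlgebra H) (τ : FNSTrace N) (hτ : τ.toFun 1 = ∞)
    (hN : IsDiffuse N ∨ ∀ x : H →L[ℂ] H, x ∈ N) (q : ℝ) (hq : 0 < q) :
    ∃ (A : H →L[ℂ] H) (ω : LInfty →ₗ[ℝ] ℝ),
      A ∈ dixmierIdeal τ ∧ 0 ≤ A ∧
      IsGeneralisedLimit ω ∧ IsDilationInvariant ω ∧
      -- the functions to which `ω` is applied are well defined elements of `L_∞(0, ∞)`
      MemLp (dixmierMean τ A) ∞ halfLine ∧
      (∀ t : ℝ, 0 < t → τ.toFun (heatOperator q A t) ≠ ∞) ∧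
      LocallyIntegrableOn (heatKernel τ q A) (Set.Ioi 0) ∧
      MemLp (cesaro (heatKernel τ q A)) ∞ halfLine ∧
      Real.Gamma (1 + 1 / q) * dixmierTrace τ ω A < heatFunctional τ q ω A := by
  obtain ⟨A, ω, hA, hA0, hlim, hinv, hmean, htrace, hheat⟩ := mainTheorem6_general N τ hτ
  obtain ⟨hfin, hint, hcesaro, hpos⟩ := hheat q hq
  exact ⟨A, ω, hA, hA0, hlim, hinv, hmean, hfin, hint, hcesaro, by rwa [htrace, mul_zero]⟩
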